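/- A partition is a weakly decreasing finite sequence of non-negative integers, identified with its Young diagram (trailing zeros are ignored); $\subseteq$ denotes inclusion of diagrams, and $(k^l)$ is the rectangular diagram with $l$ rows of length $k$. For $\mu\subseteq\lambda$, the skew diagram $\lambda/\mu$ is the set of boxes of $\lambda$ that are not in $\mu$. The Littlewood-Richardson coefficient $c(\lambda;\mu,\nu)$ is the number of semistandard tableaux of shape $\lambda/\mu$ (fillings with positive integers, weakly increasing from left to right along rows and strictly increasing down columns) with content $\nu$ (the entry $i$ occurs $\nu_i$ times) whose reverse row word (the entries read from right to left in each row, rows from top to bottom) is a lattice word, i.e. for all $i,n\ge 1$ the letter $i$ occurs among its first $n$ letters at least as often as $i+1$; and $c(\lambda;\mu,\nu)=0$ if $\mu\not\subseteq\lambda$. For a partition $\alpha\subseteq(k^l)$, $((k^l)/\alpha)^\circ$ denotes the partition whose diagram is obtained by rotating the skew diagram $(k^l)/\alpha$ by $180^\circ$, that is, the partition $(k-\alpha_l,\,k-\alpha_{l-1},\ldots,k-\alpha_1)$. **Lemma.** Let $k,l$ be positive integers and let $\lambda,\mu,\nu$ be partitions with $\nu\subseteq\lambda\subsetneq(k^l)$.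 Then $$c(\lambda;\mu,\nu)=c\Big(\big((k^l)/\nu\big)^\circ;\ \mu,\ \big((k^l)/\lambda\big)^\circ\Big).$$ -/

import Mathlib

/-! Partitions are Young diagrams, in matrix coordinates counted from `0`: the box `(i, j)` lies in
row `i` and column `j`, and `μ.rowLen i` is the part of `μ` with (zero-based) index `i`. -/

namespace LittlewoodRichardson

/-- The rectangular partition `(k ^ l)`, with `l` rows of length `k`. -/
def rect (k l : ℕ) : YoungDiagram where
  cells := Finset.range l ×ˢ Finset.range k
  isLowerSet := by
    rintro ⟨i, j⟩ ⟨i', j'⟩ ⟨hi, hj⟩ h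
    simp only [Finset.coe_product, Finset.coe_range, Set.mem_prod, Set.mem_Iio] at h hi hj ⊢
    omega

/-- The skew diagram `lam / mu`, the set of boxes of `lam` that are not in `mu`. -/
def skewCells (lam mu : YoungDiagram) : Finset (ℕ × ℕ) :=
  lam.cells \ mu.cells

/-- Rotation by 180 degrees of the rectangle with `l` rows and `k` columns. -/
def rotBox (k l : ℕ) (c : ℕ × ℕ) : ℕ × ℕ :=
  (l - 1 - c.1, k - 1 - c.2)

/-- The partition `((k ^ l) / nu)°`: the skew diagram `(k ^ l) / nu`, rotated by 180 degrees. The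
rotated diagram, which is defined up to translation only, is put in the position in which it is
the diagram of a partition. -/
def rotCompl (k l : ℕ) (nu : YoungDiagram) : YoungDiagram where
  cells := (skewCells (rect k l) nu).image (rotBox k l)
  isLowerSet := by
    rintro ⟨i, j⟩ ⟨i', j'⟩ ⟨hi, hj⟩ h
    simp only [Finset.coe_image, Set.mem_image, Finset.mem_coe, skewCells, rect, rotBox,
      Finset.mem_sdiff, Finset.mem_product, Finset.mem_range, YoungDiagram.mem_cells,
      Prod.mk.injEq, Prod.exists] at h hi hj ⊢
    obtain ⟨a, b, ⟨⟨ha, hb⟩, hn⟩, h1, h2⟩ := h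
    exact ⟨l - 1 - i', k - 1 - j', ⟨⟨by omega, by omega⟩,
      fun hm => hn (nu.up_left_mem (by omega) (by omega) hm)⟩, by omega, by omega⟩

/-- `T` is a semistandard tableau of shape `lam / mu`: the boxes of the skew diagram are filled
with positive integers, weakly increasing along rows and strictly increasing down columns. Outside
of the skew diagram `T` is set to `0`, so that tableaux are equal if and only if their fillings
are. -/
structure IsSemistandard (lam mu : YoungDiagram) (T : ℕ → ℕ → ℕ) : Prop where
  pos : ∀ i j, (i, j) ∈ skewCells lam mu → 0 < T i j
  zero : ∀ i j, (i, j) ∉ skewCells lam mu → T i j = 0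
  row_weak : ∀ i j, (i, j) ∈ skewCells lam mu → (i, j + 1) ∈ skewCells lam mu →
    T i j ≤ T i (j + 1)
  col_strict : ∀ i j, (i, j) ∈ skewCells lam mu → (i + 1, j) ∈ skewCells lam mu →
    T i j < T (i + 1) j

/-- The content of `T` is `nu`: the entry `i + 1` occurs as often as the part of `nu` with
zero-based index `i` says. -/
def HasContent (lam mu nu : YoungDiagram) (T : ℕ → ℕ → ℕ) : Prop :=
  ∀ i, ((skewCells lam mu).filter fun c => T c.1 c.2 = i + 1).card = nu.rowLen i

/-- The reverse row word: the entries of `T` in the boxes of `lam / mu`, each row read from right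
to left, the rows from top to bottom. -/
def reverseRowWord (lam mu : YoungDiagram) (T : ℕ → ℕ → ℕ) : List ℕ :=
  (List.range (lam.colLen 0)).flatMap fun i =>
    ((List.range (lam.rowLen i)).reverse.filter fun j => (i, j) ∈ skewCells lam mu).map (T i)

/-- A word is a lattice word if, among its first `n` letters, `i` occurs at least as often as
`i + 1`, for all `n` and all `i ≥ 1`. -/
def IsLatticeWord (w : List ℕ) : Prop :=
  ∀ i n, 1 ≤ i → (w.take n).count (i + 1) ≤ (w.take n).count i

/-- The LR tableaux of shape `lam / mu` with content `nu`. The shape `lam / mu` exists only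
when `mu ⊆ lam`, so that there are none otherwise. -/
def lrTableaux (lam mu nu : YoungDiagram) : Set (ℕ → ℕ → ℕ) :=
  {T | mu ≤ lam ∧ IsSemistandard lam mu T ∧ HasContent lam mu nu T ∧
    IsLatticeWord (reverseRowWord lam mu T)}

/-- The Littlewood-Richardson coefficient `c(lam; mu, nu)`: the number of LR tableaux of shape
`lam / mu` with content `nu`. -/
noncomputable def lrCoeff (lam mu nu : YoungDiagram) : ℕ :=
  (lrTableaux lam mu nu).ncard

/-- There are finitely many LR tableaux, so that `lrCoeff` is their true number. -/
theorem finite_lrTableaux (lam mu nu : YoungDiagram) : (lrTableaux lam mu nu).Finite := by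
  have hb : ∀ T ∈ lrTableaux lam mu nu, ∀ i j, T i j ≤ nu.colLen 0 := by
    rintro T ⟨-, hT, hc, -⟩ i j
    by_cases hm : (i, j) ∈ skewCells lam mu
    · have hp := hT.pos i j hm
      have h1 := hc (T i j - 1)
      have h2 : 0 < nu.rowLen (T i j - 1) := by
        rw [← h1, Finset.card_pos]
        exact ⟨(i, j), by simp only [Finset.mem_filter]; exact ⟨hm, by omega⟩⟩
      have h3 := YoungDiagram.mem_iff_lt_colLen.1 (YoungDiagram.mem_iff_lt_rowLen.2 h2)
      omega
    · rw [hT.zero i j hm]; exact Nat.zero_le _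
  let f : (ℕ → ℕ → ℕ) → ({c : ℕ × ℕ // c ∈ skewCells lam mu} → ℕ) := fun T c => T c.1.1 c.1.2
  refine Set.Finite.of_finite_image (f := f) ?_ ?_
  · refine (Set.Finite.pi' fun _ => Set.finite_Iic (nu.colLen 0)).subset ?_
    rintro _ ⟨T, hT, rfl⟩ c
    exact hb T hT _ _
  · intro T hT S hS h
    funext i j
    by_cases hm : (i, j) ∈ skewCells lam mu
    · exact congrFun h ⟨(i, j), hm⟩
    · rw [hT.2.1.zero i j hm, hS.2.1.zero i j hm]

end LittlewoodRichardson

/-! The proof is linear algebra on the partitions inside `(k ^ l)`. `hMatrix r` encodes Pieri's rule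
for `h_r`, and `schurMatrix ν` is the Jacobi-Trudi determinant in these matrices. `BoxSeq` also
contains sequences that are not decreasing, but `HStrip` forces both of its ends to be decreasing,
so these contribute nothing.

Three facts carry the argument. (1) The `hMatrix r` commute, by the Bender-Knuth involution
(`hMatrix_commute`). Hence so do the `schurMatrix ν`. (2) The entry of `schurMatrix ν` at `(μ, λ)`
is `c(λ; μ, ν)` (`schurMatrix_apply`, `lrCoeff_eq_schurMatrix`). A tableau is a chain of horizontal
strips. In the signed sum over permutations and chains, the chains violating the lattice condition
cancel: the part after the first violation is reflected by Bender-Knuth, which swaps two shifted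
contents. (3) Complementation in the rectangle transposes `hMatrix r`. Since the factors commute,
the reversed products are unchanged, so it also transposes `schurMatrix ν` (`schurMatrix_compl`).

The row of `schurMatrix μ` at the empty partition is the unit vector at `μ`, so commutation gives
`c(λ; μ, ν) = c(λ; ν, μ)`. By (3), `c(λ; ν, μ) = c(ν°; λ°, μ)`, and a second use of the symmetry
gives `c(ν°; μ, λ°)`. -/

namespace LittlewoodRichardson

/-! ### Sequences in a box and their complements -/

/-- Sequences of natural numbers that are bounded by `k` and vanish from index `l` on, such as the
row lengths of the Young diagrams inside `rect k l`. -/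
structure BoxSeq (k l : ℕ) where
  /-- The underlying function. -/
  toFun : ℕ → ℕ
  le : ∀ i, toFun i ≤ k
  apply_eq_zero : ∀ i, l ≤ i → toFun i = 0

namespace BoxSeq

variable {k l : ℕ}

instance : CoeFun (BoxSeq k l) fun _ => ℕ → ℕ := ⟨BoxSeq.toFun⟩

theorem ext {f g : BoxSeq k l} (h : ∀ i, f i = g i) : f = g := by
  cases f
  cases g
  congr
  exact funext h

theorem eq_zero (f : BoxSeq k l) {i : ℕ} (h : l ≤ i) : f i = 0 := f.apply_eq_zero i h

instance : Finite (BoxSeq k l) := by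
  refine Finite.of_injective
    (fun f (i : Fin l) => (⟨f i, Nat.lt_succ_of_le (f.le i)⟩ : Fin (k + 1))) fun f g h => ext fun i => ?_
  rcases lt_or_ge i l with hi | hi
  · exact congrArg Fin.val (congrFun h ⟨i, hi⟩)
  · rw [f.eq_zero hi, g.eq_zero hi]

noncomputable instance : Fintype (BoxSeq k l) := Fintype.ofFinite _

noncomputable instance : DecidableEq (BoxSeq k l) := Classical.decEq _

/-- The sum of a sequence. -/
def size (f : BoxSeq k l) : ℤ := ∑ i ∈ Finset.range l, (f i : ℤ)

theorem size_eq_sum (f : BoxSeq k l) {m : ℕ} (h : l ≤ m) :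
    f.size = ∑ i ∈ Finset.range m, (f i : ℤ) :=
  Finset.sum_subset (Finset.range_subset_range.2 h) fun i _ hi => by
    rw [f.eq_zero (by simpa using hi), Nat.cast_zero]

/-- The zero sequence. -/
def zero (k l : ℕ) : BoxSeq k l := ⟨fun _ => 0, fun _ => Nat.zero_le _, fun _ _ => rfl⟩

/-- The complement in the box, rotated by 180 degrees. -/
def compl (f : BoxSeq k l) : BoxSeq k l :=
  ⟨fun i => if i < l then k - f (l - 1 - i) else 0,
    fun i => by split_ifs <;> omega, fun i hi => if_neg (by omega)⟩

theorem compl_apply (f : BoxSeq k l) (i : ℕ) :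
    f.compl i = if i < l then k - f (l - 1 - i) else 0 := rfl

theorem compl_compl (f : BoxSeq k l) : f.compl.compl = f := by
  refine ext fun i => ?_
  rw [compl_apply, compl_apply]
  rcases lt_or_ge i l with hi | hi
  · have h := f.le i
    rw [if_pos hi, if_pos (by omega), show l - 1 - (l - 1 - i) = i by omega]
    omega
  · rw [if_neg (by omega), f.eq_zero hi]

theorem size_compl (f : BoxSeq k l) : f.compl.size = l * k - f.size := by
  have h : f.compl.size = ∑ i ∈ Finset.range l, ((k : ℤ) - f (l - 1 - i)) :=
    Finset.sum_congr rfl fun i hi => by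
      rw [compl_apply, if_pos (Finset.mem_range.1 hi), Nat.cast_sub (f.le _)]
  rw [h, Finset.sum_range_reflect (fun i => (k : ℤ) - f i) l, Finset.sum_sub_distrib]
  simp [size]

end BoxSeq

/-! ### Horizontal strips and Bender-Knuth reflections -/

/-- `b / a` is a horizontal strip. -/
def HStrip (a b : ℕ → ℕ) : Prop :=
  ∀ i, a i ≤ b i ∧ b (i + 1) ≤ a i

/-- The interlacing `b 0 ≥ a 0 ≥ b 1 ≥ a 1 ≥ …` is read backwards under `x ↦ k - x`. -/
theorem HStrip.compl {k l : ℕ} {a b : BoxSeq k l} (h : HStrip a b) :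
    HStrip b.compl a.compl := by
  intro i
  simp only [BoxSeq.compl_apply]
  have h1 := (h (l - 1 - i)).1
  refine ⟨by split_ifs <;> omega, ?_⟩
  split_ifs with h2 h3 h4
  · have h4 := (h (l - 1 - (i + 1))).2
    rw [show l - 1 - (i + 1) + 1 = l - 1 - i by omega] at h4
    omega
  all_goals omega

theorem hStrip_compl_iff {k l : ℕ} {a b : BoxSeq k l} :
    HStrip b.compl a.compl ↔ HStrip a b :=
  ⟨fun h => by simpa only [BoxSeq.compl_compl] using h.compl, HStrip.compl⟩

/-- The Bender-Knuth reflection of `x` between `a` and `b` in the rows from `r` on, where `t` boxes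
of `b / x` in row `r` are kept. -/
def reflectFun (a b : ℕ → ℕ) (r t : ℕ) (x : ℕ → ℕ) (i : ℕ) : ℕ :=
  if i < r then x i
  else min (b i) (if i = r then b r + max (a r) (b (r + 1)) - t - x r
    else max (a i) (b (i + 1)) + min (b i) (a (i - 1)) - x i)

/-- The conditions under which `reflectFun` preserves horizontal strips. -/
structure Reflectable (a b : ℕ → ℕ) (r t : ℕ) (x : ℕ → ℕ) : Prop where
  left : HStrip a x
  right : HStrip x b
  keep : x r + t ≤ b r
  bound : ∀ i, i + 1 = r → b r ≤ a i + t

section Reflect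

variable {a b x : ℕ → ℕ} {r t : ℕ}

theorem reflectFun_of_lt {i : ℕ} (h : i < r) : reflectFun a b r t x i = x i := if_pos h

/-- For reflectable `x`, the outer `min` and the truncated subtractions of `reflectFun` have no
effect here or in `reflectFun_succ`: each row is reflected in the interval of its admissible values.
The outer `min` only keeps `reflectFun` inside the box for arbitrary `x`. -/
theorem Reflectable.reflectFun_self (h : Reflectable a b r t x) :
    reflectFun a b r t x r + x r + t = b r + max (a r) (b (r + 1)) ∧
      max (a r) (b (r + 1)) ≤ reflectFun a b r t x r ∧ reflectFun a b r t x r + t ≤ b r := by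
  have h1 := h.left r
  have h2 := h.right r
  have h3 := h.keep
  unfold reflectFun
  rw [if_neg (lt_irrefl r), if_pos rfl]
  omega

theorem Reflectable.reflectFun_succ (h : Reflectable a b r t x) {i : ℕ} (hi : r ≤ i) :
    reflectFun a b r t x (i + 1) + x (i + 1) =
        max (a (i + 1)) (b (i + 2)) + min (b (i + 1)) (a i) ∧
      max (a (i + 1)) (b (i + 2)) ≤ reflectFun a b r t x (i + 1) ∧
      reflectFun a b r t x (i + 1) ≤ min (b (i + 1)) (a i) := by
  have h1 := h.left (i + 1)
  have h2 := h.right (i + 1)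
  have h3 := h.left i
  have h4 := h.right i
  unfold reflectFun
  rw [if_neg (by omega), if_neg (by omega), Nat.add_sub_cancel]
  simp only [add_assoc] at *
  norm_num at *
  omega

theorem Reflectable.reflect (h : Reflectable a b r t x) :
    Reflectable a b r t (reflectFun a b r t x) := by
  have h0 := h.reflectFun_self
  have key : ∀ i, HStrip a x → HStrip x b →
      a i ≤ reflectFun a b r t x i ∧ reflectFun a b r t x (i + 1) ≤ a i ∧
      reflectFun a b r t x i ≤ b i ∧ b (i + 1) ≤ reflectFun a b r t x i := by
    intro i hl hr
    have l1 := hl i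
    have r1 := hr i
    have hlow : max (a i) (b (i + 1)) ≤ reflectFun a b r t x i ∧
        reflectFun a b r t x i ≤ b i := by
      rcases lt_trichotomy i r with hi | rfl | hi
      · rw [reflectFun_of_lt hi]; omega
      · omega
      · obtain ⟨j, rfl⟩ : ∃ j, i = j + 1 := ⟨i - 1, by omega⟩
        have := h.reflectFun_succ (i := j) (by omega)
        rw [show j + 1 + 1 = j + 2 from rfl]
        omega
    have hup : reflectFun a b r t x (i + 1) ≤ a i := by
      rcases lt_trichotomy (i + 1) r with hi | hi | hi
      · rw [reflectFun_of_lt hi]; exact l1.2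
      -- The reflection in row `r` is only bounded by `b r - t`; `bound` makes this at most `a (r -
      -- 1)`.
      · have := h.bound i hi
        rw [hi]
        omega
      · have := h.reflectFun_succ (i := i) (by omega)
        omega
    omega
  exact ⟨fun i => ⟨(key i h.left h.right).1, (key i h.left h.right).2.1⟩,
    fun i => ⟨(key i h.left h.right).2.2.1, (key i h.left h.right).2.2.2⟩, h0.2.2, h.bound⟩

theorem Reflectable.reflectFun_reflectFun (h : Reflectable a b r t x) (i : ℕ) :
    reflectFun a b r t (reflectFun a b r t x) i = x i := by
  rcases lt_trichotomy i r with hi | rfl | hi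
  · rw [reflectFun_of_lt hi, reflectFun_of_lt hi]
  · have h1 := h.reflectFun_self
    have h2 := h.reflect.reflectFun_self
    omega
  · obtain ⟨j, rfl⟩ : ∃ j, i = j + 1 := ⟨i - 1, by omega⟩
    have h1 := h.reflectFun_succ (i := j) (by omega)
    have h2 := h.reflect.reflectFun_succ (i := j) (by omega)
    omega

/-- With `M i = max (a i) (b (i + 1))`, the summand in a row `i > r` is `(M i - a i) - (M (i - 1) -
a (i - 1))`, so the sum telescopes. -/
theorem Reflectable.sum_reflectFun (h : Reflectable a b r t x) (d : ℕ) :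
    ∑ i ∈ Finset.range (r + 1 + d), ((reflectFun a b r t x i : ℤ) + x i - a i - b i) =
      ∑ i ∈ Finset.range r, (2 * (x i : ℤ) - a i - b i) - t +
        max (a (r + d) : ℤ) (b (r + d + 1)) - a (r + d) := by
  induction d with
  | zero =>
    have h0 := h.reflectFun_self.1
    have h1 : ∑ i ∈ Finset.range r, ((reflectFun a b r t x i : ℤ) + x i - a i - b i) =
        ∑ i ∈ Finset.range r, (2 * (x i : ℤ) - a i - b i) :=
      Finset.sum_congr rfl fun i hi => by
        rw [reflectFun_of_lt (Finset.mem_range.1 hi)]; ring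
    rw [add_zero, Finset.sum_range_succ, h1]
    simp only [add_zero]
    zify at h0
    linarith
  | succ d ih =>
    have h0 := (h.reflectFun_succ (i := r + d) (by omega)).1
    rw [← add_assoc, Finset.sum_range_succ, ih, show r + 1 + d = r + d + 1 by ring,
      show r + (d + 1) = r + d + 1 by ring, show r + d + 1 + 1 = r + d + 2 by ring]
    have h1 := min_add_max (b (r + d + 1)) (a (r + d))
    rw [max_comm (b (r + d + 1))] at h1
    zify at h0 h1
    linarith

end Reflect

namespace BoxSeq

variable {k l : ℕ}

/-- `reflectFun` on sequences in a box. -/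
def reflect (a b : BoxSeq k l) (r t : ℕ) (x : BoxSeq k l) : BoxSeq k l :=
  ⟨reflectFun a b r t x, fun i => by
    have := x.le i
    have := b.le i
    unfold reflectFun
    split_ifs <;> omega, fun i hi => by
    have := x.eq_zero hi
    have := b.eq_zero hi
    unfold reflectFun
    split_ifs <;> omega⟩

theorem reflect_apply (a b : BoxSeq k l) (r t : ℕ) (x : BoxSeq k l) (i : ℕ) :
    reflect a b r t x i = reflectFun a b r t x i := rfl

theorem reflect_reflect {a b x : BoxSeq k l} {r t : ℕ} (h : Reflectable a b r t x) :
    reflect a b r t (reflect a b r t x) = x :=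
  ext h.reflectFun_reflectFun

/-- Below the box the boundary term of the telescoping sum vanishes. For `r = t = 0` the result says
that the sizes of the strips `x / a` and `b / x` are exchanged. -/
theorem size_reflect {a b x : BoxSeq k l} {r t : ℕ} (h : Reflectable a b r t x) :
    (reflect a b r t x).size + x.size - a.size - b.size =
      ∑ i ∈ Finset.range r, (2 * (x i : ℤ) - a i - b i) - t := by
  have h1 := h.sum_reflectFun l
  rw [b.eq_zero (show l ≤ r + l + 1 by omega), a.eq_zero (show l ≤ r + l by omega)] at h1
  have hl : l ≤ r + 1 + l := by omega
  rw [size_eq_sum _ hl, size_eq_sum _ hl, size_eq_sum _ hl, size_eq_sum _ hl,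
    ← Finset.sum_add_distrib, ← Finset.sum_sub_distrib, ← Finset.sum_sub_distrib]
  simpa [reflect_apply] using h1

end BoxSeq

/-! ### The commuting Pieri matrices -/

open Classical in
/-- The matrix of the multiplication by the complete homogeneous symmetric function of degree `r`,
in the basis of Schur functions. -/
noncomputable def hMatrix (k l : ℕ) (r : ℤ) : Matrix (BoxSeq k l) (BoxSeq k l) ℤ :=
  Matrix.of fun a b => if HStrip a b ∧ b.size = a.size + r then 1 else 0

open Classical in
theorem hMatrix_apply {k l : ℕ} (r : ℤ) (a b : BoxSeq k l) :
    hMatrix k l r a b = if HStrip a b ∧ b.size = a.size + r then 1 else 0 := rfl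

theorem hMatrix_compl {k l : ℕ} (r : ℤ) (a b : BoxSeq k l) :
    hMatrix k l r b.compl a.compl = hMatrix k l r a b := by
  classical
  rw [hMatrix_apply, hMatrix_apply]
  refine if_congr (and_congr hStrip_compl_iff ?_) rfl rfl
  rw [BoxSeq.size_compl, BoxSeq.size_compl]
  constructor <;> intro h <;> linarith

/-- Both products count the intermediate `x` between `a` and `b`, with the two strip sizes in either
order; the full Bender-Knuth reflection is a bijection between them. -/
theorem hMatrix_commute (k l : ℕ) (r s : ℤ) : Commute (hMatrix k l r) (hMatrix k l s) := by
  classical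
  ext a b
  rw [Matrix.mul_apply, Matrix.mul_apply]
  simp only [hMatrix_apply, ite_zero_mul_ite_zero, mul_one]
  rw [← Finset.sum_filter, ← Finset.sum_filter]
  have key : ∀ r s : ℤ, ∀ x : BoxSeq k l,
      ((HStrip a x ∧ x.size = a.size + r) ∧ HStrip x b ∧ b.size = x.size + s) →
      Reflectable a b 0 0 x ∧ ((HStrip a (BoxSeq.reflect a b 0 0 x) ∧
        (BoxSeq.reflect a b 0 0 x).size = a.size + s) ∧ HStrip (BoxSeq.reflect a b 0 0 x) b ∧
        b.size = (BoxSeq.reflect a b 0 0 x).size + r) := by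
    rintro r s x ⟨⟨h1, h2⟩, h3, h4⟩
    have h : Reflectable a b 0 0 x := ⟨h1, h3, (h3 0).1, fun i hi => by omega⟩
    have hs := BoxSeq.size_reflect h
    simp only [Finset.range_zero, Finset.sum_empty, Nat.cast_zero] at hs
    exact ⟨h, ⟨h.reflect.left, by linarith⟩, h.reflect.right, by linarith⟩
  refine Finset.sum_nbij' (BoxSeq.reflect a b 0 0) (BoxSeq.reflect a b 0 0) ?_ ?_ ?_ ?_ ?_
  · intro x hx
    exact Finset.mem_filter.2 ⟨Finset.mem_univ _, (key r s x (Finset.mem_filter.1 hx).2).2⟩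
  · intro x hx
    exact Finset.mem_filter.2 ⟨Finset.mem_univ _, (key s r x (Finset.mem_filter.1 hx).2).2⟩
  · intro x hx
    exact BoxSeq.reflect_reflect (key r s x (Finset.mem_filter.1 hx).2).1
  · intro x hx
    exact BoxSeq.reflect_reflect (key s r x (Finset.mem_filter.1 hx).2).1
  · intro _ _
    rfl

/-- The entries of a product of matrices are sums over paths. -/
theorem list_prod_ofFn_apply {P R : Type*} [Fintype P] [DecidableEq P] [CommRing R] {N : ℕ}
    (M : Fin N → Matrix P P R) (a b : P) :
    (List.ofFn M).prod a b =
      ∑ κ : Fin (N + 1) → P,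
        if κ 0 = a ∧ κ (Fin.last N) = b then ∏ p, M p (κ p.castSucc) (κ p.succ) else 0 := by
  induction N generalizing a with
  | zero =>
    rw [List.ofFn_zero, List.prod_nil, ← (Equiv.funUnique (Fin 1) P).symm.sum_comp]
    simp only [Matrix.one_apply, Equiv.funUnique_symm_apply, uniqueElim_const,
      Finset.univ_eq_empty, Finset.prod_empty]
    by_cases h : a = b
    · subst h
      simp
    · rw [if_neg h, Finset.sum_eq_zero]
      rintro x -
      rw [if_neg]
      rintro ⟨rfl, h'⟩
      exact h h'
  | succ N ih =>
    rw [List.ofFn_succ, List.prod_cons, Matrix.mul_apply,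
      ← (Fin.consEquiv fun _ : Fin (N + 2) => P).sum_comp, Fintype.sum_prod_type, Finset.sum_comm]
    simp only [ih, Finset.mul_sum]
    rw [Finset.sum_comm]
    refine Finset.sum_congr rfl fun κ _ => ?_
    have h1 : ∀ x : P, (Fin.consEquiv fun _ : Fin (N + 2) => P) (x, κ) = Fin.cons x κ :=
      fun _ => rfl
    simp only [h1, Fin.cons_zero, ← Fin.succ_last, Fin.cons_succ, Fin.prod_univ_succ (n := N),
      Fin.castSucc_zero, ← Fin.succ_castSucc]
    rw [Finset.sum_eq_single (κ 0), Finset.sum_eq_single a]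
    · by_cases h : κ (Fin.last N) = b <;> simp [h]
    · intro x _ hx
      rw [if_neg fun h => hx h.1]
    · simp
    · intro c _ hc
      rw [if_neg fun h => hc h.1.symm, mul_zero]
    · simp

/-! ### Paths of horizontal strips and the lattice condition -/

variable {k l n : ℕ}

/-- `κ` is a path of horizontal strips from `a` to `b`. -/
structure IsPath (a b : BoxSeq k l) (κ : Fin (n + 2) → BoxSeq k l) : Prop where
  first : κ 0 = a
  last : κ (Fin.last (n + 1)) = b
  strip : ∀ p : Fin (n + 1), HStrip (κ p.castSucc) (κ p.succ)

/-- The sizes of the strips of a path. -/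
def content (κ : Fin (n + 2) → BoxSeq k l) (p : Fin (n + 1)) : ℤ :=
  (κ p.succ).size - (κ p.castSucc).size

/-- The number of boxes of the strip `j + 1` in the rows up to `i`, minus the number of boxes of the
strip `j` in the rows before `i`. -/
def excess (κ : Fin (n + 2) → BoxSeq k l) (j : Fin n) (i : ℕ) : ℤ :=
  ∑ r ∈ Finset.range (i + 1), ((κ j.succ.succ r : ℤ) - κ j.succ.castSucc r) -
    ∑ r ∈ Finset.range i, ((κ j.succ.castSucc r : ℤ) - κ j.castSucc.castSucc r)

/-- The lattice condition for a path. -/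
def IsLatticePath (κ : Fin (n + 2) → BoxSeq k l) : Prop :=
  ∀ j i, excess κ j i ≤ 0

theorem excess_congr {κ κ' : Fin (n + 2) → BoxSeq k l} {i : ℕ} (j : Fin n)
    (h0 : ∀ r < i, κ j.castSucc.castSucc r = κ' j.castSucc.castSucc r)
    (h1 : ∀ r ≤ i, κ j.succ.castSucc r = κ' j.succ.castSucc r)
    (h2 : ∀ r ≤ i, κ j.succ.succ r = κ' j.succ.succ r) :
    excess κ j i = excess κ' j i := by
  unfold excess
  congr 1 <;> refine Finset.sum_congr rfl fun r hr => ?_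
  · have := Finset.mem_range.1 hr
    rw [h1 r (by omega), h2 r (by omega)]
  · have := Finset.mem_range.1 hr
    rw [h1 r (by omega), h0 r (by omega)]

/-- The lattice condition fails first in row `r`, where `j` is the largest index at which it
fails. -/
structure FirstFailure (κ : Fin (n + 2) → BoxSeq k l) (r : ℕ) (j : Fin n) : Prop where
  fail : 0 < excess κ j r
  before : ∀ i < r, ∀ j', excess κ j' i ≤ 0
  after : ∀ j', j < j' → excess κ j' r ≤ 0

theorem exists_firstFailure {κ : Fin (n + 2) → BoxSeq k l} (h : ¬ IsLatticePath κ) :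
    ∃ q : ℕ × Fin n, FirstFailure κ q.1 q.2 := by
  classical
  have h1 : ∃ i j, 0 < excess κ j i := by
    unfold IsLatticePath at h
    push Not at h
    exact ⟨_, _, h.choose_spec.choose_spec⟩
  let s : Finset (Fin n) := Finset.univ.filter fun j => 0 < excess κ j (Nat.find h1)
  have hs : s.Nonempty := by
    obtain ⟨j, hj⟩ := Nat.find_spec h1
    exact ⟨j, Finset.mem_filter.2 ⟨Finset.mem_univ _, hj⟩⟩
  refine ⟨(Nat.find h1, s.max' hs), (Finset.mem_filter.1 (s.max'_mem hs)).2, fun i hi j' => ?_,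
    fun j' hj' => ?_⟩
  · by_contra hc
    exact Nat.find_min h1 hi ⟨j', not_le.1 hc⟩
  · by_contra hc
    exact not_le.2 hj' (s.le_max' j' (Finset.mem_filter.2 ⟨Finset.mem_univ _, not_le.1 hc⟩))

theorem FirstFailure.unique {κ : Fin (n + 2) → BoxSeq k l} {q q' : ℕ × Fin n}
    (h : FirstFailure κ q.1 q.2) (h' : FirstFailure κ q'.1 q'.2) : q = q' := by
  have h1 : q.1 = q'.1 := by
    rcases lt_trichotomy q.1 q'.1 with hl | hl | hl
    · exact absurd h.fail (not_lt.2 (h'.before _ hl _))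
    · exact hl
    · exact absurd h'.fail (not_lt.2 (h.before _ hl _))
  refine Prod.ext h1 ?_
  rcases lt_trichotomy q.2 q'.2 with hl | hl | hl
  · exact absurd h'.fail (not_lt.2 (h1 ▸ h.after _ hl))
  · exact hl
  · exact absurd h.fail (not_lt.2 (h1 ▸ h'.after _ hl))

/-! ### Reflecting a path at its first failure -/

/-- The number of letters `j + 1` of row `r` that are read up to the failure of the lattice
condition. -/
def failCount (κ : Fin (n + 2) → BoxSeq k l) (r : ℕ) (j : Fin n) : ℕ :=
  (∑ i ∈ Finset.range r, ((κ j.succ.castSucc i : ℤ) - κ j.castSucc.castSucc i) + 1 -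
    ∑ i ∈ Finset.range r, ((κ j.succ.succ i : ℤ) - κ j.succ.castSucc i)).toNat

/-- Reflects the rest of the path after the failure of the lattice condition. -/
def flip (κ : Fin (n + 2) → BoxSeq k l) (r : ℕ) (j : Fin n) : Fin (n + 2) → BoxSeq k l :=
  Function.update κ j.succ.castSucc
    (BoxSeq.reflect (κ j.castSucc.castSucc) (κ j.succ.succ) r (failCount κ r j)
      (κ j.succ.castSucc))

section Flip

variable {κ : Fin (n + 2) → BoxSeq k l} {r : ℕ} {j : Fin n} {a b : BoxSeq k l}

theorem flip_self : flip κ r j j.succ.castSucc =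
    BoxSeq.reflect (κ j.castSucc.castSucc) (κ j.succ.succ) r (failCount κ r j)
      (κ j.succ.castSucc) := Function.update_self ..

theorem flip_of_ne {m : Fin (n + 2)} (h : m.val ≠ j.val + 1) : flip κ r j m = κ m :=
  Function.update_of_ne (fun he => h (by rw [he]; simp)) ..

theorem flip_apply_of_lt (m : Fin (n + 2)) {i : ℕ} (h : i < r) : flip κ r j m i = κ m i := by
  by_cases hm : m = j.succ.castSucc
  · rw [hm, flip_self, BoxSeq.reflect_apply, reflectFun_of_lt h]
  · rw [flip, Function.update_of_ne hm]

theorem flip_left : flip κ r j j.castSucc.castSucc = κ j.castSucc.castSucc :=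
  flip_of_ne (by simp)

theorem flip_right : flip κ r j j.succ.succ = κ j.succ.succ :=
  flip_of_ne (by simp)

theorem IsPath.strip_left (h : IsPath a b κ) (j : Fin n) :
    HStrip (κ j.castSucc.castSucc) (κ j.succ.castSucc) := by
  have := h.strip j.castSucc
  rwa [Fin.succ_castSucc] at this

/-- The `toNat` does not truncate: the lattice condition in row `r - 1` bounds the subtracted sum.
-/
theorem FirstFailure.failCount_eq (h : IsPath a b κ) (hf : FirstFailure κ r j) :
    (failCount κ r j : ℤ) =
      ∑ i ∈ Finset.range r, ((κ j.succ.castSucc i : ℤ) - κ j.castSucc.castSucc i) + 1 -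
        ∑ i ∈ Finset.range r, ((κ j.succ.succ i : ℤ) - κ j.succ.castSucc i) := by
  refine Int.toNat_of_nonneg ?_
  rcases r with _ | r
  · simp
  · have h1 := hf.before r (Nat.lt_succ_self r) j
    have h2 := (h.strip_left j r).1
    unfold excess at h1
    rw [Finset.sum_range_succ _ r]
    zify at h2
    linarith

/-- The failure in row `r` provides enough boxes to keep. The lattice condition in row `r - 1`
ensures that the boxes of row `r` lying below a box of the preceding strip are among those kept, so
the others may change. -/
theorem FirstFailure.reflectable (h : IsPath a b κ) (hf : FirstFailure κ r j) :
    Reflectable (κ j.castSucc.castSucc) (κ j.succ.succ) r (failCount κ r j)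
      (κ j.succ.castSucc) := by
  have ht := hf.failCount_eq h
  refine ⟨h.strip_left j, h.strip j.succ, ?_, ?_⟩
  · have h1 := hf.fail
    unfold excess at h1
    rw [Finset.sum_range_succ] at h1
    zify
    linarith
  · rintro i rfl
    have h1 := hf.before i (Nat.lt_succ_self i) j
    have h2 := (h.strip j.succ i).2
    unfold excess at h1
    rw [Finset.sum_range_succ (fun i => (κ j.succ.castSucc i : ℤ) - κ j.castSucc.castSucc i)] at ht
    zify at h2 ⊢
    linarith

theorem failCount_flip : failCount (flip κ r j) r j = failCount κ r j := by
  have h : ∀ m m' : Fin (n + 2), ∑ i ∈ Finset.range r, ((flip κ r j m i : ℤ) - flip κ r j m' i) =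
      ∑ i ∈ Finset.range r, ((κ m i : ℤ) - κ m' i) := fun m m' =>
    Finset.sum_congr rfl fun i hi => by
      rw [flip_apply_of_lt m (Finset.mem_range.1 hi), flip_apply_of_lt m' (Finset.mem_range.1 hi)]
  rw [failCount, failCount, h, h]

theorem FirstFailure.flip_flip (h : IsPath a b κ) (hf : FirstFailure κ r j) :
    flip (flip κ r j) r j = κ := by
  funext m
  by_cases hm : m = j.succ.castSucc
  · rw [hm, flip_self, failCount_flip, flip_left, flip_right, flip_self]
    exact BoxSeq.reflect_reflect (hf.reflectable h)
  · rw [flip, Function.update_of_ne hm, flip, Function.update_of_ne hm]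

theorem FirstFailure.isPath_flip (h : IsPath a b κ) (hf : FirstFailure κ r j) :
    IsPath a b (flip κ r j) := by
  have hr := (hf.reflectable h).reflect
  refine ⟨?_, ?_, fun p => ?_⟩
  · rw [flip_of_ne (by simp), h.first]
  · rw [flip_of_ne (by simp; omega), h.last]
  · by_cases h1 : p = j.castSucc
    · rw [h1, flip_left, Fin.succ_castSucc, flip_self]
      exact hr.left
    · by_cases h2 : p = j.succ
      · rw [h2, flip_right, flip_self]
        exact hr.right
      · rw [flip_of_ne, flip_of_ne]
        · exact h.strip p
        · intro he
          exact h1 (Fin.ext (by simpa using he))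
        · intro he
          exact h2 (Fin.ext (by simpa using he))

/-- Everything read up to the failure is unchanged. Rows are read from right to left, so larger
letters come first; this is why `j` is taken largest. The flip may change the excess at smaller
indices in row `r`, on which `FirstFailure` imposes nothing. -/
theorem FirstFailure.flip (h : IsPath a b κ) (hf : FirstFailure κ r j) :
    FirstFailure (flip κ r j) r j := by
  refine ⟨?_, fun i hi j' => ?_, fun j' hj' => ?_⟩
  · have h1 := (hf.reflectable h).reflect.keep
    unfold excess
    rw [Finset.sum_range_succ, flip_self, flip_left, flip_right, BoxSeq.reflect_apply]
    have e1 : ∀ i ∈ Finset.range r, reflectFun (κ j.castSucc.castSucc) (κ j.succ.succ) r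
        (failCount κ r j) (κ j.succ.castSucc) i = κ j.succ.castSucc i :=
      fun i hi => reflectFun_of_lt (Finset.mem_range.1 hi)
    have e2 := hf.failCount_eq h
    have e3 : ∑ i ∈ Finset.range r, ((κ j.succ.succ i : ℤ) - (BoxSeq.reflect
        (κ j.castSucc.castSucc) (κ j.succ.succ) r (failCount κ r j) (κ j.succ.castSucc)) i) =
        ∑ i ∈ Finset.range r, ((κ j.succ.succ i : ℤ) - κ j.succ.castSucc i) :=
      Finset.sum_congr rfl fun i hi => by rw [BoxSeq.reflect_apply, e1 i hi]
    have e4 : ∑ i ∈ Finset.range r, (((BoxSeq.reflect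
        (κ j.castSucc.castSucc) (κ j.succ.succ) r (failCount κ r j) (κ j.succ.castSucc)) i : ℤ) -
          κ j.castSucc.castSucc i) =
        ∑ i ∈ Finset.range r, ((κ j.succ.castSucc i : ℤ) - κ j.castSucc.castSucc i) :=
      Finset.sum_congr rfl fun i hi => by rw [BoxSeq.reflect_apply, e1 i hi]
    rw [e3, e4]
    zify at h1
    linarith
  · rw [excess_congr (κ' := κ) j' (fun r' hr' => flip_apply_of_lt _ (by omega))
      (fun r' hr' => flip_apply_of_lt _ (by omega)) (fun r' hr' => flip_apply_of_lt _ (by omega))]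
    exact hf.before i hi j'
  · have hj : j.val < j'.val := hj'
    -- For `j' = j + 1` the changed member of the path enters `excess` only through the rows before
    -- `r`, where it is unchanged.
    rw [excess_congr (κ' := κ) j' (fun r' hr' => flip_apply_of_lt _ (by omega))
      (fun r' _ => by rw [flip_of_ne (by simp; omega)])
      (fun r' _ => by rw [flip_of_ne (by simp; omega)])]
    exact hf.after j' hj'

/-- By the choice of `failCount`, the right side of `size_reflect` is `-1`. So the two contents are
exchanged up to a shift by one, which is the shift in the Jacobi-Trudi determinant. -/
theorem FirstFailure.content_flip (h : IsPath a b κ) (hf : FirstFailure κ r j) (p : Fin (n + 1)) :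
    content (LittlewoodRichardson.flip κ r j) p - p =
      content κ (Equiv.swap j.castSucc j.succ p) - Equiv.swap j.castSucc j.succ p := by
  have hs := BoxSeq.size_reflect (hf.reflectable h)
  have e := hf.failCount_eq h
  have e1 : ∑ i ∈ Finset.range r, (2 * (κ j.succ.castSucc i : ℤ) - κ j.castSucc.castSucc i -
      κ j.succ.succ i) =
      ∑ i ∈ Finset.range r, ((κ j.succ.castSucc i : ℤ) - κ j.castSucc.castSucc i) -
        ∑ i ∈ Finset.range r, ((κ j.succ.succ i : ℤ) - κ j.succ.castSucc i) := by
    rw [← Finset.sum_sub_distrib]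
    exact Finset.sum_congr rfl fun i _ => by ring
  rw [e1] at hs
  unfold content
  by_cases h1 : p = j.castSucc
  · rw [h1, Equiv.swap_apply_left, Fin.succ_castSucc, flip_self, flip_left]
    simp only [Fin.val_castSucc, Fin.val_succ]
    push_cast
    linarith
  · by_cases h2 : p = j.succ
    · rw [h2, Equiv.swap_apply_right, flip_self, flip_right, Fin.succ_castSucc]
      simp only [Fin.val_castSucc, Fin.val_succ]
      push_cast
      linarith
    · rw [Equiv.swap_apply_of_ne_of_ne h1 h2, flip_of_ne, flip_of_ne]
      · intro he
        exact h2 (Fin.ext (by simpa using he))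
      · intro he
        exact h1 (Fin.ext (by simpa using he))

end Flip

theorem IsLatticePath.content_le {κ : Fin (n + 2) → BoxSeq k l} (h : IsLatticePath κ) (j : Fin n) :
    content κ j.succ ≤ content κ j.castSucc := by
  -- In row `l`, below the box, both sums of `excess` exhaust their strips.
  have h1 := h j l
  unfold excess at h1
  rw [Finset.sum_sub_distrib, Finset.sum_sub_distrib, ← BoxSeq.size_eq_sum _ (Nat.le_succ l),
    ← BoxSeq.size_eq_sum _ (Nat.le_succ l), ← BoxSeq.size_eq_sum _ le_rfl,
    ← BoxSeq.size_eq_sum _ le_rfl] at h1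
  unfold content
  rw [Fin.succ_castSucc]
  linarith

/-! ### Jacobi-Trudi matrices and the cancellation of non-lattice paths -/

/-- The matrix of the multiplication by the Schur function of `ν`, expanded by the Jacobi-Trudi
determinant with `n + 1` rows. -/
noncomputable def schurMatrix (k l n : ℕ) (ν : ℕ → ℕ) : Matrix (BoxSeq k l) (BoxSeq k l) ℤ :=
  ∑ w : Equiv.Perm (Fin (n + 1)), (Equiv.Perm.sign w : ℤ) •
    (List.ofFn fun p : Fin (n + 1) => hMatrix k l (ν (w p) - (w p : ℕ) + (p : ℕ))).prod

theorem schurMatrix_commute (ν μ : ℕ → ℕ) :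
    Commute (schurMatrix k l n ν) (schurMatrix k l n μ) := by
  refine Commute.sum_left _ _ _ fun w _ => Commute.sum_right _ _ _ fun v _ =>
    Commute.smul_left (Commute.smul_right (Commute.list_prod_left _ _ fun x hx =>
      Commute.list_prod_right _ _ fun y hy => ?_) _) _
  rw [List.mem_ofFn] at hx hy
  obtain ⟨p, rfl⟩ := hx
  obtain ⟨q, rfl⟩ := hy
  exact hMatrix_commute ..

/-- Complementation followed by transposition fixes each `hMatrix` and reverses products;
commutativity undoes the reversal. -/
theorem schurMatrix_compl (ν : ℕ → ℕ) (a b : BoxSeq k l) :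
    schurMatrix k l n ν b.compl a.compl = schurMatrix k l n ν a b := by
  let e : BoxSeq k l ≃ BoxSeq k l := ⟨BoxSeq.compl, BoxSeq.compl, BoxSeq.compl_compl,
    BoxSeq.compl_compl⟩
  have hH : ∀ r, ((hMatrix k l r).submatrix e e).transpose = hMatrix k l r := fun r => by
    ext a b
    exact hMatrix_compl r a b
  have hL : ∀ L : List ℤ, (((L.map (hMatrix k l)).prod).submatrix e e).transpose =
      ((L.map (hMatrix k l)).reverse).prod := by
    intro L
    induction L with
    | nil => simp
    | cons r L ih =>
      rw [List.map_cons, List.prod_cons, List.reverse_cons, List.prod_append, ← ih,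
        ← Matrix.submatrix_mul_equiv _ _ e e e, Matrix.transpose_mul, hH, List.prod_singleton]
  have hrev : ∀ L : List ℤ, ((L.map (hMatrix k l)).reverse).prod = (L.map (hMatrix k l)).prod := by
    intro L
    induction L with
    | nil => simp
    | cons r L ih =>
      rw [List.map_cons, List.prod_cons, List.reverse_cons, List.prod_append, ih,
        List.prod_singleton]
      refine Commute.list_prod_left _ _ fun x hx => ?_
      obtain ⟨s, -, rfl⟩ := List.mem_map.1 hx
      exact hMatrix_commute ..
  have hS : ((schurMatrix k l n ν).submatrix e e).transpose = schurMatrix k l n ν := by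
    ext a b
    simp only [schurMatrix, Matrix.transpose_apply, Matrix.submatrix_apply, Matrix.sum_apply,
      Matrix.smul_apply]
    refine Finset.sum_congr rfl fun w _ => ?_
    have := congrFun (congrFun ((hL (List.ofFn fun p : Fin (n + 1) =>
      ((ν (w p) : ℤ) - (w p : ℕ) + (p : ℕ)))).trans (hrev _)) a) b
    rw [List.map_ofFn] at this
    exact congrArg _ this
  exact congrFun (congrFun hS a) b

open Classical in
theorem schurMatrix_apply_eq_sum (ν : ℕ → ℕ) (a b : BoxSeq k l) :
    schurMatrix k l n ν a b =
      ∑ x : Equiv.Perm (Fin (n + 1)) × (Fin (n + 2) → BoxSeq k l) with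
        IsPath a b x.2 ∧ ∀ p, content x.2 p - p = ν (x.1 p) - (x.1 p : ℕ),
        (Equiv.Perm.sign x.1 : ℤ) := by
  rw [Finset.sum_filter, Fintype.sum_prod_type, schurMatrix, Matrix.sum_apply]
  refine Finset.sum_congr rfl fun w _ => ?_
  rw [Matrix.smul_apply, list_prod_ofFn_apply, Finset.smul_sum]
  refine Finset.sum_congr rfl fun κ _ => ?_
  simp only [hMatrix_apply]
  rw [Finset.prod_ite_zero, ← ite_and, smul_ite, smul_zero]
  simp only [Finset.prod_const_one, smul_eq_mul, mul_one]
  refine if_congr ⟨?_, ?_⟩ rfl rfl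
  · rintro ⟨⟨h1, h2⟩, h3⟩
    refine ⟨⟨h1, h2, fun p => (h3 p (Finset.mem_univ _)).1⟩, fun p => ?_⟩
    have := (h3 p (Finset.mem_univ _)).2
    unfold content
    linarith
  · rintro ⟨h, h3⟩
    refine ⟨⟨h.first, h.last⟩, fun p _ => ⟨h.strip p, ?_⟩⟩
    have := h3 p
    unfold content at this
    linarith

open Classical in
/-- The entries of `schurMatrix` count lattice paths. -/
theorem schurMatrix_apply {ν : ℕ → ℕ} (hν : Antitone ν) (a b : BoxSeq k l) :
    schurMatrix k l n ν a b =
      Finset.card {κ : Fin (n + 2) → BoxSeq k l | IsPath a b κ ∧ IsLatticePath κ ∧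
        ∀ p, content κ p = ν p} := by
  rw [schurMatrix_apply_eq_sum, ← Finset.sum_filter_add_sum_filter_not _
    (fun x => IsLatticePath x.2), Finset.filter_filter, Finset.filter_filter]
  have hz : ∑ x : Equiv.Perm (Fin (n + 1)) × (Fin (n + 2) → BoxSeq k l) with
      (IsPath a b x.2 ∧ ∀ p, content x.2 p - p = ν (x.1 p) - (x.1 p : ℕ)) ∧ ¬ IsLatticePath x.2,
      (Equiv.Perm.sign x.1 : ℤ) = 0 := by
    let q : ∀ κ : Fin (n + 2) → BoxSeq k l, ¬ IsLatticePath κ → ℕ × Fin n :=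
      fun κ h => (exists_firstFailure h).choose
    have hq : ∀ κ h, FirstFailure κ (q κ h).1 (q κ h).2 :=
      fun κ h => (exists_firstFailure h).choose_spec
    -- A flipped path has the same first failure, so flipping twice at the chosen position is the
    -- identity.
    have hqf : ∀ κ h h', IsPath a b κ → q (flip κ (q κ h).1 (q κ h).2) h' = q κ h :=
      fun κ h h' hp => (hq _ h').unique ((hq κ h).flip hp)
    have hm : ∀ x ∈ (Finset.univ.filter fun x : Equiv.Perm (Fin (n + 1)) ×
        (Fin (n + 2) → BoxSeq k l) => (IsPath a b x.2 ∧
          ∀ p, content x.2 p - p = ν (x.1 p) - (x.1 p : ℕ)) ∧ ¬ IsLatticePath x.2),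
        ¬ IsLatticePath x.2 := fun x hx => (Finset.mem_filter.1 hx).2.2
    refine Finset.sum_involution (fun x hx =>
      (x.1 * Equiv.swap (q x.2 (hm x hx)).2.castSucc (q x.2 (hm x hx)).2.succ,
        flip x.2 (q x.2 (hm x hx)).1 (q x.2 (hm x hx)).2)) ?_ ?_ ?_ ?_
    · intro x hx
      rw [Equiv.Perm.sign_mul, Equiv.Perm.sign_swap (Fin.castSucc_lt_succ).ne]
      simp
    · intro x hx _ he
      have h1 := congrArg (fun y => Equiv.Perm.sign y.1) he
      simp only [Equiv.Perm.sign_mul, Equiv.Perm.sign_swap (Fin.castSucc_lt_succ).ne] at h1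
      rcases Int.units_eq_one_or (Equiv.Perm.sign x.1) with h | h <;> rw [h] at h1 <;>
        exact absurd h1 (by decide)
    · intro x hx
      obtain ⟨-, ⟨h1, h2⟩, h3⟩ := Finset.mem_filter.1 hx
      have hf := hq x.2 (hm x hx)
      refine Finset.mem_filter.2 ⟨Finset.mem_univ _, ⟨hf.isPath_flip h1, fun p => ?_⟩, fun hl =>
        absurd (hl _ _) (not_le.2 (hf.flip h1).fail)⟩
      rw [hf.content_flip h1, h2, Equiv.Perm.mul_apply]
    · intro x hx
      have h1 := (Finset.mem_filter.1 hx).2.1.1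
      have hf := hq x.2 (hm x hx)
      have h' : ¬ IsLatticePath (flip x.2 (q x.2 (hm x hx)).1 (q x.2 (hm x hx)).2) :=
        fun hl => absurd (hl _ _) (not_le.2 (hf.flip h1).fail)
      have he := hqf x.2 (hm x hx) h' h1
      refine Prod.ext ?_ ?_
      · dsimp only
        rw [he, mul_assoc, Equiv.swap_mul_self, mul_one]
      · dsimp only
        rw [he]
        exact hf.flip_flip h1
  rw [hz, add_zero, Finset.card_eq_sum_ones, Nat.cast_sum]
  -- For a lattice path `content p - p` is strictly decreasing, as is `ν i - i`; so the permutation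
  -- is increasing, hence trivial.
  have hw : ∀ x : Equiv.Perm (Fin (n + 1)) × (Fin (n + 2) → BoxSeq k l),
      (∀ p, content x.2 p - p = ν (x.1 p) - (x.1 p : ℕ)) → IsLatticePath x.2 → x.1 = 1 := by
    intro x h1 h2
    have hm : StrictMono x.1 := by
      refine Fin.strictMono_iff_lt_succ.2 fun j => ?_
      have h3 := h1 j.succ
      have h4 := h1 j.castSucc
      have h5 := h2.content_le j
      simp only [Fin.val_castSucc, Fin.val_succ] at h3 h4
      push_cast at h3
      by_contra hc
      have h6 : (x.1 j.succ : ℕ) ≤ x.1 j.castSucc := not_lt.1 hc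
      have h7 := hν h6
      zify at h6 h7
      linarith
    refine Equiv.ext fun p => ?_
    exact DFunLike.congr_fun (Subsingleton.elim
      (hm.orderIsoOfSurjective x.1 x.1.surjective) (OrderIso.refl _)) p
  refine Finset.sum_nbij' (fun x => x.2) (fun κ => (1, κ)) ?_ ?_ ?_ ?_ ?_
  · intro x hx
    obtain ⟨-, ⟨h1, h2⟩, h3⟩ := Finset.mem_filter.1 hx
    refine Finset.mem_filter.2 ⟨Finset.mem_univ _, h1, h3, fun p => ?_⟩
    have := h2 p
    rw [hw x h2 h3, Equiv.Perm.one_apply] at this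
    linarith
  · intro κ hκ
    obtain ⟨-, h1, h2, h3⟩ := Finset.mem_filter.1 hκ
    exact Finset.mem_filter.2 ⟨Finset.mem_univ _, ⟨h1, fun p => by simp [h3]⟩, h2⟩
  · intro x hx
    obtain ⟨-, ⟨h1, h2⟩, h3⟩ := Finset.mem_filter.1 hx
    exact Prod.ext (hw x h2 h3).symm rfl
  · intro _ _
    rfl
  · intro x hx
    obtain ⟨-, ⟨h1, h2⟩, h3⟩ := Finset.mem_filter.1 hx
    rw [hw x h2 h3]
    simp

/-! ### Paths from the empty partition and the symmetry of the coefficients -/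

section ZeroPath

variable {k n : ℕ}

/-- The path of the superstandard tableau. -/
def superPath (μ : BoxSeq k (n + 1)) (p : Fin (n + 2)) : BoxSeq k (n + 1) :=
  ⟨fun i => if i < p then μ i else 0, fun i => by
    have := μ.le i
    split_ifs <;> omega, fun i hi => by rw [μ.eq_zero hi, ite_self]⟩

theorem superPath_apply (μ : BoxSeq k (n + 1)) (p : Fin (n + 2)) (i : ℕ) :
    superPath μ p i = if i < p then μ i else 0 := rfl

theorem superPath_sub (μ : BoxSeq k (n + 1)) (p : Fin (n + 1)) (i : ℕ) :
    (superPath μ p.succ i : ℤ) - superPath μ p.castSucc i = if i = p then (μ p : ℤ) else 0 := by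
  simp only [superPath_apply, Fin.val_succ, Fin.val_castSucc]
  rcases lt_trichotomy i p with h | rfl | h
  · rw [if_pos (by omega), if_pos h, if_neg h.ne, sub_self]
  · simp
  · rw [if_neg (by omega), if_neg (by omega), if_neg h.ne', sub_self]

theorem isPath_superPath {μ : BoxSeq k (n + 1)} (hμ : Antitone μ.toFun) :
    IsPath (BoxSeq.zero k (n + 1)) μ (superPath μ) := by
  refine ⟨BoxSeq.ext fun i => ?_, BoxSeq.ext fun i => ?_, fun p i => ?_⟩
  · simp [superPath_apply, BoxSeq.zero]
  · rw [superPath_apply, Fin.val_last]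
    split_ifs with h
    · rfl
    · rw [μ.eq_zero (by omega)]
  · have h1 : μ (i + 1) ≤ μ i := hμ (Nat.le_succ i)
    simp only [superPath_apply, Fin.val_succ, Fin.val_castSucc]
    split_ifs <;> omega

theorem isLatticePath_superPath {μ : BoxSeq k (n + 1)} (hμ : Antitone μ.toFun) :
    IsLatticePath (superPath μ) := by
  intro j i
  unfold excess
  simp only [superPath_sub, ← Fin.succ_castSucc, Finset.sum_ite_eq', Finset.mem_range,
    Fin.val_castSucc]
  simp only [Fin.succ_castSucc, superPath_sub, Finset.sum_ite_eq', Finset.mem_range, Fin.val_succ]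
  have h1 : (μ (j + 1) : ℤ) ≤ μ j := by exact_mod_cast hμ (Nat.le_succ j)
  split_ifs <;> omega

theorem content_superPath (μ : BoxSeq k (n + 1)) (p : Fin (n + 1)) :
    content (superPath μ) p = μ p := by
  unfold content BoxSeq.size
  rw [← Finset.sum_sub_distrib]
  simp only [superPath_sub, Finset.sum_ite_eq', Finset.mem_range]
  rw [if_pos p.isLt]

/-- The strip conditions keep strip `p` out of the rows after `p` (`hA`), and the lattice condition
keeps it out of the rows before `p` (`hB`). So it lies in row `p`, and the content gives its length
(`hC`). -/
theorem IsPath.eq_superPath {μ b : BoxSeq k (n + 1)} {κ : Fin (n + 2) → BoxSeq k (n + 1)}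
    (h : IsPath (BoxSeq.zero k (n + 1)) b κ) (hl : IsLatticePath κ)
    (hc : ∀ p, content κ p = μ p) : κ = superPath μ := by
  have hA : ∀ p : Fin (n + 2), ∀ i, p.val ≤ i → κ p i = 0 := by
    intro p
    induction p using Fin.induction with
    | zero => intro i _; rw [h.first]; rfl
    | succ p ih =>
      intro i hi
      rw [Fin.val_succ] at hi
      obtain ⟨i, rfl⟩ : ∃ i', i = i' + 1 := ⟨i - 1, by omega⟩
      have h1 := (h.strip p i).2
      rw [ih i (by rw [Fin.val_castSucc]; omega)] at h1
      omega
  have hB : ∀ p : Fin (n + 1), ∀ i < p.val, κ p.succ i = κ p.castSucc i := by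
    intro p
    induction p using Fin.induction with
    | zero => intro i hi; exact absurd hi (Nat.not_lt_zero i)
    | succ j ih =>
      intro i hi
      rw [Fin.val_succ] at hi
      have h1 := hl j i
      unfold excess at h1
      rw [Finset.sum_eq_zero (s := Finset.range i)] at h1
      · have h2 : ∀ r ∈ Finset.range (i + 1),
            (0 : ℤ) ≤ (κ j.succ.succ r : ℤ) - κ j.succ.castSucc r := fun r _ => by
          have := (h.strip j.succ r).1
          omega
        have h3 := Finset.single_le_sum h2 (Finset.self_mem_range_succ i)
        have h4 := h2 i (Finset.self_mem_range_succ i)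
        omega
      · intro r hr
        have h2 := ih r (by have := Finset.mem_range.1 hr; rw [Fin.val_castSucc]; omega)
        rw [Fin.succ_castSucc] at h2
        omega
  have hC : ∀ p : Fin (n + 1), κ p.succ p = μ p := by
    intro p
    have h1 := hc p
    unfold content BoxSeq.size at h1
    rw [← Finset.sum_sub_distrib, Finset.sum_eq_single p.val, hA p.castSucc p (by simp)] at h1
    · simpa using h1
    · intro i _ hi
      rcases lt_or_gt_of_ne hi with hi | hi
      · rw [hB p i hi, sub_self]
      · rw [hA p.castSucc i (by simpa using hi.le), hA p.succ i (by simpa using hi), sub_self]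
    · intro hn
      exact absurd (Finset.mem_range.2 p.isLt) hn
  funext p
  refine BoxSeq.ext fun i => ?_
  induction p using Fin.induction with
  | zero => rw [h.first]; simp [superPath_apply, BoxSeq.zero]
  | succ p ih =>
    rw [superPath_apply] at ih ⊢
    rw [Fin.val_succ]
    rw [Fin.val_castSucc] at ih
    rcases lt_trichotomy i p with hi | rfl | hi
    · rw [hB p i hi, ih, if_pos hi, if_pos (by omega)]
    · rw [hC, if_pos (by omega)]
    · rw [hA p.succ i (by simpa using hi), if_neg (by omega)]

theorem schurMatrix_zero {μ : BoxSeq k (n + 1)} (hμ : Antitone μ.toFun) (b : BoxSeq k (n + 1)) :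
    schurMatrix k (n + 1) n μ (BoxSeq.zero k (n + 1)) b = if b = μ then 1 else 0 := by
  classical
  rw [schurMatrix_apply hμ]
  split_ifs with hb
  · subst hb
    rw [Nat.cast_eq_one, Finset.card_eq_one]
    refine ⟨superPath b, Finset.ext fun κ => ?_⟩
    rw [Finset.mem_filter, Finset.mem_singleton]
    constructor
    · rintro ⟨-, h1, h2, h3⟩
      exact h1.eq_superPath h2 h3
    · rintro rfl
      exact ⟨Finset.mem_univ _, isPath_superPath hμ, isLatticePath_superPath hμ,
        content_superPath b⟩
  · rw [Nat.cast_eq_zero, Finset.card_eq_zero, Finset.filter_eq_empty_iff]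
    rintro κ - ⟨h1, h2, h3⟩
    have h4 := h1.last
    rw [h1.eq_superPath h2 h3, (isPath_superPath hμ).last] at h4
    exact hb h4.symm

/-- By `schurMatrix_zero` both sides are the entry at `(0, b)` of a product of the same two
commuting matrices. -/
theorem schurMatrix_symm {μ ν : BoxSeq k (n + 1)} (hμ : Antitone μ.toFun) (hν : Antitone ν.toFun)
    (b : BoxSeq k (n + 1)) :
    schurMatrix k (n + 1) n ν μ b = schurMatrix k (n + 1) n μ ν b := by
  have key : ∀ {μ ν : BoxSeq k (n + 1)}, Antitone μ.toFun →
      (schurMatrix k (n + 1) n μ * schurMatrix k (n + 1) n ν) (BoxSeq.zero k (n + 1)) b =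
        schurMatrix k (n + 1) n ν μ b := by
    intro μ ν hμ
    rw [Matrix.mul_apply]
    simp only [schurMatrix_zero hμ, ite_mul, one_mul, zero_mul, Finset.sum_ite_eq', Finset.mem_univ,
      if_true]
  rw [← key hμ, ← key hν, schurMatrix_commute]

end ZeroPath

/-! ### Prefixes of words and counting -/

section Lists

theorem countP_range (q : ℕ → Prop) [DecidablePred q] (n : ℕ) :
    (List.range n).countP (fun c => decide (q c)) = Nat.count q n := by
  induction n with
  | zero => simp
  | succ n ih => rw [List.range_succ, List.countP_append, ih, Nat.count_succ]; simp

theorem count_flatMap_range (f : ℕ → List ℕ) (v m : ℕ) :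
    ((List.range m).flatMap f).count v = ∑ i ∈ Finset.range m, (f i).count v := by
  induction m with
  | zero => simp
  | succ m ih =>
    rw [List.range_succ, List.flatMap_append, List.count_append, ih, Finset.sum_range_succ]
    simp

theorem prefix_flatMap_range {f : ℕ → List ℕ} {m : ℕ} {w : List ℕ}
    (h : w <+: (List.range m).flatMap f) :
    w = [] ∨ ∃ i < m, ∃ q, q <+: f i ∧ w = (List.range i).flatMap f ++ q := by
  induction m with
  | zero => left; simpa using h
  | succ m ih =>
    obtain ⟨u, hu⟩ := h
    rw [List.range_succ, List.flatMap_append, List.flatMap_singleton,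
      List.append_eq_append_iff] at hu
    rcases hu with ⟨s, h1, -⟩ | ⟨s, h1, h2⟩
    · rcases ih ⟨s, h1.symm⟩ with h | ⟨i, hi, h⟩
      · exact Or.inl h
      · exact Or.inr ⟨i, by omega, h⟩
    · exact Or.inr ⟨m, by omega, s, ⟨u, h2.symm⟩, h1⟩

theorem flatMap_range_append_prefix {f : ℕ → List ℕ} {m i : ℕ} (hi : i < m) {q : List ℕ}
    (hq : q <+: f i) : (List.range i).flatMap f ++ q <+: (List.range m).flatMap f := by
  induction m, hi using Nat.le_induction with
  | base =>
    rw [List.range_succ, List.flatMap_append, List.flatMap_singleton, List.prefix_append_right_inj]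
    exact hq
  | succ m _ ih =>
    rw [List.range_succ (n := m), List.flatMap_append]
    exact ih.trans (List.prefix_append ..)

theorem exists_prefix_of_pairwise_ge {w : List ℕ} (h : w.Pairwise (· ≥ ·)) (v : ℕ) :
    ∃ q, q <+: w ∧ q.count v = 0 ∧ q.count (v + 1) = w.count (v + 1) := by
  induction w with
  | nil => exact ⟨[], List.prefix_rfl, rfl, rfl⟩
  | cons x w ih =>
    rw [List.pairwise_cons] at h
    rcases lt_or_ge v x with hx | hx
    -- The prefix consists of the letters greater than `v`; it is the worst one for the lattice
    -- condition.
    · obtain ⟨q, h1, h2, h3⟩ := ih h.2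
      refine ⟨x :: q, (List.cons_prefix_cons).2 ⟨rfl, h1⟩, ?_, ?_⟩
      · rw [List.count_cons_of_ne (by omega), h2]
      · rw [List.count_cons, List.count_cons, h3]
    · refine ⟨[], List.nil_prefix, rfl, ?_⟩
      rw [List.count_nil, eq_comm, List.count_eq_zero]
      intro hm
      rcases List.mem_cons.1 hm with hm | hm
      · omega
      · have := h.1 _ hm
        omega

theorem isLatticeWord_iff_prefix {w : List ℕ} :
    IsLatticeWord w ↔ ∀ v, 1 ≤ v → ∀ q, q <+: w → q.count (v + 1) ≤ q.count v := by
  constructor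
  · intro h v hv q hq
    rw [List.prefix_iff_eq_take.1 hq]
    exact h v _ hv
  · intro h v m hv
    exact h v hv _ (List.take_prefix _ _)

/-- The lattice condition for a word that is made of weakly decreasing pieces. -/
theorem isLatticeWord_flatMap_range {f : ℕ → List ℕ} {m : ℕ}
    (hf : ∀ i, (f i).Pairwise (· ≥ ·)) (hm : ∀ i, m ≤ i → f i = []) :
    IsLatticeWord ((List.range m).flatMap f) ↔ ∀ v, 1 ≤ v → ∀ i,
      ∑ r ∈ Finset.range (i + 1), (f r).count (v + 1) ≤
        ∑ r ∈ Finset.range i, (f r).count v := by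
  rw [isLatticeWord_iff_prefix]
  constructor
  · intro h v hv i
    obtain ⟨q, h1, h2, h3⟩ := exists_prefix_of_pairwise_ge (hf i) v
    have hp : (List.range i).flatMap f ++ q <+: (List.range m).flatMap f := by
      rcases lt_or_ge i m with hi | hi
      · exact flatMap_range_append_prefix hi h1
      -- The pieces from `m` on are empty, so the prefix is the whole word.
      · rw [hm i hi, List.prefix_nil] at h1
        subst h1
        rw [List.append_nil]
        clear h2 h3
        induction i, hi using Nat.le_induction with
        | base => exact List.prefix_rfl
        | succ i hi ih =>
          rw [List.range_succ, List.flatMap_append, List.flatMap_singleton, hm i hi,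
            List.append_nil]
          exact ih
    have h4 := h v hv _ hp
    rwa [List.count_append, List.count_append, h2, h3, count_flatMap_range, count_flatMap_range,
      ← Finset.sum_range_succ] at h4
  · intro h v hv w hw
    rcases prefix_flatMap_range hw with rfl | ⟨i, -, q, hq, rfl⟩
    · simp
    · rw [List.count_append, List.count_append, count_flatMap_range, count_flatMap_range]
      have h1 := h v hv i
      rw [Finset.sum_range_succ] at h1
      have h2 := hq.sublist.count_le (v + 1)
      omega

theorem lt_count_iff {q : ℕ → Prop} [DecidablePred q] {N c : ℕ}
    (hq : ∀ c c', c ≤ c' → c' < N → q c' → q c) (hc : c < N) : c < Nat.count q N ↔ q c := by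
  induction N with
  | zero => omega
  | succ N ih =>
    by_cases hN : q N
    · have hall : ∀ c' < N + 1, q c' := fun c' h => hq c' N (by omega) (by omega) hN
      rw [Nat.count_iff_forall.2 hall]
      exact ⟨fun _ => hall c hc, fun _ => hc⟩
    · rw [Nat.count_succ, if_neg hN, add_zero]
      rcases Nat.lt_succ_iff_lt_or_eq.1 hc with h | rfl
      · exact ih (fun c c' h1 h2 => hq c c' h1 (by omega)) h
      · exact ⟨fun h => absurd h (not_lt.2 (Nat.count_le _)), fun h => absurd h hN⟩

theorem count_lt_of_le {N m : ℕ} (h : m ≤ N) : Nat.count (fun c => c < m) N = m := by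
  induction N, h using Nat.le_induction with
  | base => exact Nat.count_iff_forall.2 fun _ h => h
  | succ N hN ih => rw [Nat.count_succ, ih, if_neg (by omega), add_zero]

theorem count_le_succ (f : ℕ → ℕ) (p N : ℕ) :
    Nat.count (fun c => f c ≤ p + 1) N =
      Nat.count (fun c => f c ≤ p) N + Nat.count (fun c => f c = p + 1) N := by
  induction N with
  | zero => simp
  | succ N ih =>
    rw [Nat.count_succ, Nat.count_succ, Nat.count_succ, ih]
    split_ifs <;> omega

theorem count_congr_of_lt {q q' : ℕ → Prop} [DecidablePred q] [DecidablePred q'] {N : ℕ}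
    (h : ∀ c < N, (q c ↔ q' c)) : Nat.count q N = Nat.count q' N := by
  rw [Nat.count_eq_card_filter_range, Nat.count_eq_card_filter_range]
  exact congrArg _ (Finset.filter_congr fun c hc => h c (Finset.mem_range.1 hc))

end Lists

/-! ### Tableaux as lattice paths -/

section Tableaux

variable {lam mu : YoungDiagram} {T : ℕ → ℕ → ℕ}

theorem mem_skewCells {i j : ℕ} :
    (i, j) ∈ skewCells lam mu ↔ mu.rowLen i ≤ j ∧ j < lam.rowLen i := by
  rw [skewCells, Finset.mem_sdiff, YoungDiagram.mem_cells, YoungDiagram.mem_cells,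
    YoungDiagram.mem_iff_lt_rowLen, YoungDiagram.mem_iff_lt_rowLen, not_lt, and_comm]

theorem le_iff_rowLen_le {mu lam : YoungDiagram} :
    mu ≤ lam ↔ ∀ i, mu.rowLen i ≤ lam.rowLen i := by
  constructor
  · intro h i
    refine le_of_forall_lt fun c hc => ?_
    exact YoungDiagram.mem_iff_lt_rowLen.1 (h (YoungDiagram.mem_iff_lt_rowLen.2 hc))
  · rintro h ⟨i, j⟩ hm
    exact YoungDiagram.mem_iff_lt_rowLen.2
      ((YoungDiagram.mem_iff_lt_rowLen.1 hm).trans_le (h i))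

/-- The default value `0` on the boxes of `mu` makes the full row of `lam` weakly increasing. -/
theorem IsSemistandard.monotone_row (h : IsSemistandard lam mu T) {i c c' : ℕ} (hc : c ≤ c')
    (hc' : c' < lam.rowLen i) : T i c ≤ T i c' := by
  induction c', hc using Nat.le_induction with
  | base => exact le_rfl
  | succ d hd ih =>
    refine (ih (by omega)).trans ?_
    by_cases h1 : mu.rowLen i ≤ d
    · exact h.row_weak i d (mem_skewCells.2 ⟨h1, by omega⟩) (mem_skewCells.2 ⟨by omega, hc'⟩)
    · rw [h.zero i d (by rw [mem_skewCells]; omega)]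
      exact Nat.zero_le _

theorem isLatticeWord_reverseRowWord_iff (h : IsSemistandard lam mu T) :
    IsLatticeWord (reverseRowWord lam mu T) ↔ ∀ v, 1 ≤ v → ∀ i,
      ∑ r ∈ Finset.range (i + 1), Nat.count (fun c => T r c = v + 1) (lam.rowLen r) ≤
        ∑ r ∈ Finset.range i, Nat.count (fun c => T r c = v) (lam.rowLen r) := by
  have hcount : ∀ v, 1 ≤ v → ∀ i,
      (((List.range (lam.rowLen i)).reverse.filter
        fun j => (i, j) ∈ skewCells lam mu).map (T i)).count v =
      Nat.count (fun c => T i c = v) (lam.rowLen i) := by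
    intro v hv i
    rw [List.count, List.countP_map, List.countP_filter, List.countP_reverse, ← countP_range]
    refine List.countP_congr fun c _ => ?_
    simp only [Function.comp_apply, Bool.and_eq_true, beq_iff_eq, decide_eq_true_eq,
      and_iff_left_iff_imp]
    intro hT
    by_contra hn
    rw [h.zero i c hn] at hT
    omega
  rw [reverseRowWord, isLatticeWord_flatMap_range]
  · refine forall_congr' fun v => forall_congr' fun hv => forall_congr' fun i => ?_
    rw [Finset.sum_congr rfl fun r _ => hcount (v + 1) (by omega) r,
      Finset.sum_congr rfl fun r _ => hcount v hv r]
  · intro i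
    refine List.Pairwise.map (R := fun c' c => c ≤ c' ∧ c' < lam.rowLen i) _
      (fun c' c hc => h.monotone_row hc.1 hc.2) (List.Pairwise.filter _ ?_)
    refine List.pairwise_reverse.2 (List.Pairwise.imp_of_mem ?_ List.pairwise_lt_range)
    intro c c' _ hc' hlt
    exact ⟨hlt.le, List.mem_range.1 hc'⟩
  · intro i hi
    have h0 : lam.rowLen i = 0 := by
      by_contra hne
      have := YoungDiagram.mem_iff_lt_colLen.1
        (YoungDiagram.mem_iff_lt_rowLen.2 (Nat.pos_of_ne_zero hne))
      omega
    rw [h0]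
    rfl

theorem card_filter_skewCells (h : IsSemistandard lam mu T) {l : ℕ}
    (hl : ∀ i, l ≤ i → lam.rowLen i = 0) (v : ℕ) :
    ((skewCells lam mu).filter fun c => T c.1 c.2 = v + 1).card =
      ∑ i ∈ Finset.range l, Nat.count (fun c => T i c = v + 1) (lam.rowLen i) := by
  rw [Finset.card_eq_sum_card_fiberwise (f := Prod.fst) (t := Finset.range l)]
  · refine Finset.sum_congr rfl fun i _ => ?_
    rw [Nat.count_eq_card_filter_range]
    symm
    refine Finset.card_nbij' (fun c => (i, c)) Prod.snd ?_ ?_ ?_ ?_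
    · intro c hc
      obtain ⟨h1, h2⟩ := Finset.mem_filter.1 hc
      refine Finset.mem_filter.2 ⟨Finset.mem_filter.2 ⟨?_, h2⟩, rfl⟩
      by_contra hn
      rw [h.zero i c hn] at h2
      omega
    · rintro ⟨i', c⟩ hc
      obtain ⟨h1, rfl⟩ := Finset.mem_filter.1 hc
      obtain ⟨h1, h2⟩ := Finset.mem_filter.1 h1
      exact Finset.mem_filter.2 ⟨Finset.mem_range.2 (mem_skewCells.1 h1).2, h2⟩
    · intro c _
      rfl
    · rintro ⟨i', c⟩ hc
      obtain ⟨h1, rfl⟩ := Finset.mem_filter.1 hc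
      rfl
  · rintro ⟨i, c⟩ hc
    have h1 := mem_skewCells.1 (Finset.mem_filter.1 hc).1
    refine Finset.mem_coe.2 (Finset.mem_range.2 ?_)
    by_contra hn
    rw [hl i (not_lt.1 hn)] at h1
    omega

variable {k l n : ℕ}

/-- The path `κ` describes the tableau `T`: the entries up to `p` in row `i` are those in the
first `κ p i` columns. -/
structure Describes (L : BoxSeq k l) (T : ℕ → ℕ → ℕ) (κ : Fin (n + 2) → BoxSeq k l) : Prop where
  le_iff : ∀ i c, c < L i → ∀ p : Fin (n + 2), T i c ≤ p ↔ c < κ p i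
  le_row : ∀ p i, κ p i ≤ L i
  entry_le : ∀ i c, T i c ≤ n + 1
  entry_zero : ∀ i c, L i ≤ c → T i c = 0

section Describes

variable {L : BoxSeq k l} {κ κ' : Fin (n + 2) → BoxSeq k l} {T' : ℕ → ℕ → ℕ}

theorem Describes.tableau_unique (h : Describes L T κ) (h' : Describes L T' κ) : T = T' := by
  have key : ∀ {T T' : ℕ → ℕ → ℕ}, Describes L T κ → Describes L T' κ → ∀ i c, T i c ≤ T' i c := by
    intro T T' h h' i c
    rcases lt_or_ge c (L i) with hc | hc
    · exact (h.le_iff i c hc ⟨T' i c, Nat.lt_succ_of_le (h'.entry_le i c)⟩).2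
        ((h'.le_iff i c hc ⟨T' i c, Nat.lt_succ_of_le (h'.entry_le i c)⟩).1 le_rfl)
    · rw [h.entry_zero i c hc]
      exact Nat.zero_le _
  funext i c
  exact le_antisymm (key h h' i c) (key h' h i c)

theorem Describes.path_unique (h : Describes L T κ) (h' : Describes L T κ') : κ = κ' := by
  have key : ∀ {κ κ' : Fin (n + 2) → BoxSeq k l}, Describes L T κ → Describes L T κ' →
      ∀ p i, κ p i ≤ κ' p i := by
    intro κ κ' h h' p i
    refine le_of_forall_lt fun c hc => ?_
    have hL := hc.trans_le (h.le_row p i)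
    exact (h'.le_iff i c hL p).1 ((h.le_iff i c hL p).2 hc)
  exact funext fun p => BoxSeq.ext fun i => le_antisymm (key h h' p i) (key h' h p i)

theorem Describes.count_le (h : Describes L T κ) (p : Fin (n + 2)) (i : ℕ) :
    Nat.count (fun c => T i c ≤ p) (L i) = κ p i := by
  rw [← count_lt_of_le (h.le_row p i)]
  exact count_congr_of_lt fun c hc => h.le_iff i c hc p

theorem Describes.count_eq (h : Describes L T κ) (p : Fin (n + 1)) (i : ℕ) :
    (Nat.count (fun c => T i c = p.val + 1) (L i) : ℤ) = (κ p.succ i : ℤ) - κ p.castSucc i := by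
  rw [← h.count_le, ← h.count_le, Fin.val_succ, Fin.val_castSucc, count_le_succ]
  push_cast
  ring

theorem Describes.count_eq_zero (h : Describes L T κ) {v : ℕ} (hv : n + 1 < v) (i : ℕ) :
    Nat.count (fun c => T i c = v) (L i) = 0 := by
  rw [Nat.count_eq_card_filter_range, Finset.card_eq_zero, Finset.filter_eq_empty_iff]
  intro c _ hc
  have := h.entry_le i c
  omega

theorem Describes.content_eq (h : Describes L T κ) (p : Fin (n + 1)) :
    content κ p =
      (∑ i ∈ Finset.range l, Nat.count (fun c => T i c = p.val + 1) (L i) : ℕ) := by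
  rw [content, BoxSeq.size, BoxSeq.size, ← Finset.sum_sub_distrib, Nat.cast_sum]
  exact Finset.sum_congr rfl fun i _ => (h.count_eq p i).symm

theorem Describes.excess_eq (h : Describes L T κ) (j : Fin n) (i : ℕ) :
    excess κ j i =
      (∑ r ∈ Finset.range (i + 1), Nat.count (fun c => T r c = j.val + 1 + 1) (L r) : ℕ) -
      (∑ r ∈ Finset.range i, Nat.count (fun c => T r c = j.val + 1) (L r) : ℕ) := by
  rw [excess, Nat.cast_sum, Nat.cast_sum]
  congr 1
  · exact Finset.sum_congr rfl fun r _ => (h.count_eq j.succ r).symm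
  · refine Finset.sum_congr rfl fun r _ => ?_
    have := h.count_eq j.castSucc r
    rw [Fin.succ_castSucc] at this
    exact this.symm

end Describes

theorem exists_describes_of_isPath {a L : BoxSeq k l} {κ : Fin (n + 2) → BoxSeq k l}
    (h : IsPath a L κ) : ∃ T, Describes L T κ := by
  have hmono : ∀ i, Monotone fun p => κ p i := fun i =>
    Fin.monotone_iff_le_succ.2 fun p => (h.strip p i).1
  have hlast : ∀ p i, κ p i ≤ L i := fun p i => by
    rw [← h.last]
    exact hmono i (Fin.le_last p)
  -- As `κ p i` increases with `p`, the number of `p` with `κ p i ≤ c` is the least `p` with `c < κ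
  -- p i`: the entry of the box.
  refine ⟨fun i c => if c < L i then Finset.card {p : Fin (n + 2) | κ p i ≤ c} else 0,
    fun i c hc p => ?_, hlast, fun i c => ?_, fun i c hc => if_neg (not_lt.2 hc)⟩
  · rw [if_pos hc]
    constructor
    · intro hle
      by_contra hn
      have hsub : Finset.univ.filter (fun q : Fin (n + 2) => q.val < p.val + 1) ⊆
          Finset.univ.filter (fun q : Fin (n + 2) => κ q i ≤ c) := fun q hq => by
        have hq' := (Finset.mem_filter.1 hq).2
        exact Finset.mem_filter.2 ⟨Finset.mem_univ _,
          (hmono i (show q ≤ p from Nat.lt_succ_iff.1 hq')).trans (not_lt.1 hn)⟩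
      have h1 := Finset.card_le_card hsub
      rw [Fin.card_filter_val_lt] at h1
      have := p.isLt
      omega
    · intro hlt
      have hsub : Finset.univ.filter (fun q : Fin (n + 2) => κ q i ≤ c) ⊆
          Finset.univ.filter (fun q : Fin (n + 2) => q.val < p.val) := fun q hq => by
        have hq' := (Finset.mem_filter.1 hq).2
        refine Finset.mem_filter.2 ⟨Finset.mem_univ _, ?_⟩
        by_contra hn
        have := hmono i (show p ≤ q from not_lt.1 hn)
        dsimp only at this
        omega
      have h1 := Finset.card_le_card hsub
      rw [Fin.card_filter_val_lt] at h1
      omega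
  · split_ifs with hc
    · have hsub : Finset.univ.filter (fun q : Fin (n + 2) => κ q i ≤ c) ⊆
          Finset.univ.filter (fun q : Fin (n + 2) => q.val < n + 1) := fun q hq => by
        have hq' := (Finset.mem_filter.1 hq).2
        refine Finset.mem_filter.2 ⟨Finset.mem_univ _, ?_⟩
        by_contra hn
        have : q = Fin.last (n + 1) := Fin.ext (by have := q.isLt; rw [Fin.val_last]; omega)
        rw [this, h.last] at hq'
        omega
      have h1 := Finset.card_le_card hsub
      rw [Fin.card_filter_val_lt] at h1
      omega
    · exact Nat.zero_le _

theorem exists_describes_of_isSemistandard {L : BoxSeq k l} (hL : ∀ i, L i = lam.rowLen i)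
    (h : IsSemistandard lam mu T) (hT : ∀ i c, T i c ≤ n + 1) :
    ∃ κ : Fin (n + 2) → BoxSeq k l, Describes L T κ := by
  have hle : ∀ (p : Fin (n + 2)) i, Nat.count (fun c => T i c ≤ p) (L i) ≤ L i :=
    fun _ _ => Nat.count_le _
  refine ⟨fun p => ⟨fun i => Nat.count (fun c => T i c ≤ p) (L i),
    fun i => (hle p i).trans (L.le i), fun i hi => ?_⟩, fun i c hc p => ?_, hle, hT, fun i c hc => ?_⟩
  · have := hle p i
    rw [L.eq_zero hi] at this ⊢
    omega
  · refine (lt_count_iff (q := fun c => T i c ≤ p) (fun c c' h1 h2 h3 => ?_) hc).symm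
    exact (h.monotone_row h1 (by rwa [← hL])).trans h3
  · refine h.zero i c ?_
    rw [mem_skewCells, ← hL]
    omega

/-- LR tableaux are described by the lattice paths from `mu` to `lam`. -/
theorem Describes.mem_lrTableaux_iff {nu : YoungDiagram} {L M : BoxSeq k l}
    {κ : Fin (n + 2) → BoxSeq k l} (hL : ∀ i, L i = lam.rowLen i) (hM : ∀ i, M i = mu.rowLen i)
    (hnu : ∀ i, n < i → nu.rowLen i = 0) (h : Describes L T κ) :
    T ∈ lrTableaux lam mu nu ↔
      IsPath M L κ ∧ IsLatticePath κ ∧ ∀ p, content κ p = nu.rowLen p := by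
  have hl : ∀ i, l ≤ i → lam.rowLen i = 0 := fun i hi => by rw [← hL, L.eq_zero hi]
  have hskew : ∀ {i c}, (i, c) ∈ skewCells lam mu ↔ M i ≤ c ∧ c < L i := by
    intro i c
    rw [mem_skewCells, hM, hL]
  constructor
  · rintro ⟨hle, hT, hc, hw⟩
    rw [isLatticeWord_reverseRowWord_iff hT] at hw
    simp only [HasContent, card_filter_skewCells hT hl] at hc
    simp only [← hL] at hc hw
    rw [le_iff_rowLen_le] at hle
    simp only [← hL, ← hM] at hle
    refine ⟨⟨BoxSeq.ext fun i => ?_, BoxSeq.ext fun i => ?_, fun p i => ⟨?_, ?_⟩⟩, fun j i => ?_,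
      fun p => ?_⟩
    -- The path starts at `mu` because the boxes of `mu` are exactly those of `lam` with entry `0`.
    · have h0 : ∀ c, c < L i → (c < M i ↔ c < κ 0 i) := by
        intro c hcL
        rw [← h.le_iff i c hcL 0]
        constructor
        · intro hcM
          rw [hT.zero i c (by rw [hskew]; omega)]
          exact Nat.zero_le _
        · intro h1
          by_contra hcM
          have := hT.pos i c (hskew.2 ⟨by omega, hcL⟩)
          rw [Fin.val_zero] at h1
          omega
      have h1 := h.le_row 0 i
      have h2 := hle i
      refine le_antisymm (le_of_forall_lt fun c hlt => ?_) (le_of_forall_lt fun c hlt => ?_)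
      · exact (h0 c (by omega)).2 hlt
      · exact (h0 c (by omega)).1 hlt
    · refine le_antisymm (h.le_row _ i) (le_of_forall_lt fun c hlt => ?_)
      exact (h.le_iff i c hlt _).1 (h.entry_le i c)
    · refine le_of_forall_lt fun c hlt => ?_
      have hcL := hlt.trans_le (h.le_row _ i)
      have h1 := (h.le_iff i c hcL _).2 hlt
      refine (h.le_iff i c hcL _).1 ?_
      rw [Fin.val_succ]
      rw [Fin.val_castSucc] at h1
      omega
    · refine le_of_forall_lt fun c hlt => ?_
      have hcL := hlt.trans_le (h.le_row _ _)
      have hcL' : c < L i := by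
        have := lam.rowLen_anti i (i + 1) (Nat.le_succ i)
        rw [← hL, ← hL] at this
        omega
      have h1 := (h.le_iff (i + 1) c hcL _).2 hlt
      refine (h.le_iff i c hcL' _).1 ?_
      rw [Fin.val_succ] at h1
      rw [Fin.val_castSucc]
      -- If the box above lies in `mu`, its entry is `0`; otherwise the columns are strict.
      by_cases hc1 : (i, c) ∈ skewCells lam mu
      · have hc2 : (i + 1, c) ∈ skewCells lam mu := by
          rw [hskew] at hc1 ⊢
          have := mu.rowLen_anti i (i + 1) (Nat.le_succ i)
          rw [← hM, ← hM] at this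
          omega
        have := hT.col_strict i c hc1 hc2
        omega
      · rw [hT.zero i c hc1]
        exact Nat.zero_le _
    · rw [h.excess_eq]
      have := hw (j.val + 1) (by omega) i
      omega
    · rw [h.content_eq, hc]
  · rintro ⟨hp, hlat, hc⟩
    have hT : IsSemistandard lam mu T := by
      refine ⟨fun i c hm => ?_, fun i c hm => ?_, fun i c h1 h2 => ?_, fun i c h1 h2 => ?_⟩
      · rw [hskew] at hm
        by_contra hn
        have := (h.le_iff i c hm.2 0).1 (by rw [Fin.val_zero]; omega)
        rw [hp.first] at this
        omega
      · rw [hskew] at hm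
        by_cases hcL : L i ≤ c
        · exact h.entry_zero i c hcL
        · have := (h.le_iff i c (by omega) 0).2 (by rw [hp.first]; omega)
          rw [Fin.val_zero] at this
          omega
      · rw [hskew] at h1 h2
        have hlt := Nat.lt_succ_of_le (h.entry_le i (c + 1))
        have h3 := (h.le_iff i (c + 1) h2.2 ⟨T i (c + 1), hlt⟩).1 le_rfl
        exact (h.le_iff i c h1.2 ⟨T i (c + 1), hlt⟩).2 (by omega)
      · rw [hskew] at h1 h2
        have hle := h.entry_le (i + 1) c
        rcases Nat.eq_zero_or_eq_succ_pred (T (i + 1) c) with h0 | h0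
        · have := (h.le_iff (i + 1) c h2.2 0).1 (by rw [h0]; exact Nat.zero_le _)
          rw [hp.first] at this
          omega
        -- The lower entry is `p + 1`; the strip condition at `p` forces the entry above it to be at
        -- most `p`.
        · let p : Fin (n + 1) := ⟨(T (i + 1) c).pred, by omega⟩
          have h3 := (h.le_iff (i + 1) c h2.2 p.succ).1 h0.le
          have h4 := (hp.strip p i).2
          have h5 : T i c ≤ (T (i + 1) c).pred := (h.le_iff i c h1.2 p.castSucc).2 (by omega)
          omega
    refine ⟨le_iff_rowLen_le.2 fun i => ?_, hT, fun v => ?_, ?_⟩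
    · rw [← hM, ← hL, ← hp.first]
      exact h.le_row 0 i
    · rw [card_filter_skewCells hT hl]
      simp only [← hL]
      rcases lt_or_ge v (n + 1) with hv | hv
      · have h1 := h.content_eq ⟨v, hv⟩
        rw [hc] at h1
        exact_mod_cast h1.symm
      · rw [hnu v (by omega)]
        exact Finset.sum_eq_zero fun i _ => h.count_eq_zero (by omega) i
    · rw [isLatticeWord_reverseRowWord_iff hT]
      simp only [← hL]
      intro v hv i
      rcases lt_or_ge n v with hvn | hvn
      · rw [Finset.sum_eq_zero fun r _ => h.count_eq_zero (by omega) r]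
        exact Nat.zero_le _
      · have h1 := hlat ⟨v - 1, by omega⟩ i
        rw [h.excess_eq] at h1
        simp only [Nat.sub_add_cancel hv] at h1
        omega

open Classical in
-- `Describes` is a bijection between LR tableaux and lattice paths; the content bounds the entries
-- by `n + 1`, so `n + 1` strips suffice.
theorem lrCoeff_eq_schurMatrix {nu : YoungDiagram} {L M : BoxSeq k l}
    (hL : ∀ i, L i = lam.rowLen i) (hM : ∀ i, M i = mu.rowLen i)
    (hnu : ∀ i, n < i → nu.rowLen i = 0) :
    (lrCoeff lam mu nu : ℤ) = schurMatrix k l n nu.rowLen M L := by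
  rw [schurMatrix_apply fun i j hij => nu.rowLen_anti i j hij, lrCoeff, Nat.cast_inj,
    ← Set.ncard_coe_finset]
  have hex : ∀ T ∈ lrTableaux lam mu nu, ∃ κ : Fin (n + 2) → BoxSeq k l, Describes L T κ := by
    intro T hT
    refine exists_describes_of_isSemistandard hL hT.2.1 fun i c => ?_
    by_contra hn
    have hm : (i, c) ∈ skewCells lam mu := by
      by_contra hm
      have := hT.2.1.zero i c hm
      omega
    have h1 := hT.2.2.1 (T i c - 1)
    rw [hnu _ (by omega), Finset.card_eq_zero, Finset.filter_eq_empty_iff] at h1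
    exact h1 hm (by dsimp only; omega)
  choose f hf using hex
  refine Set.ncard_congr f (fun T hT => ?_) (fun T T' hT hT' he => ?_) (fun κ hκ => ?_)
  · rw [Finset.mem_coe, Finset.mem_filter]
    exact ⟨Finset.mem_univ _, ((hf T hT).mem_lrTableaux_iff hL hM hnu).1 hT⟩
  · have h1 := hf T hT
    rw [he] at h1
    exact h1.tableau_unique (hf T' hT')
  · rw [Finset.mem_coe, Finset.mem_filter] at hκ
    obtain ⟨T, hT⟩ := exists_describes_of_isPath hκ.2.1
    have hm := (hT.mem_lrTableaux_iff hL hM hnu).2 hκ.2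
    exact ⟨T, hm, (hf T hm).path_unique hT⟩

end Tableaux

/-! ### Complements in the rectangle -/

section Complement

variable {k l : ℕ}

theorem rowLen_rect (i : ℕ) : (rect k l).rowLen i = if i < l then k else 0 := by
  refine eq_of_forall_lt_iff fun c => ?_
  rw [← YoungDiagram.mem_iff_lt_rowLen, ← YoungDiagram.mem_cells]
  simp only [rect, Finset.mem_product, Finset.mem_range]
  split_ifs with h <;> omega

/-- The row lengths of a Young diagram in a box. -/
def boxRows {lam : YoungDiagram} (h : lam ≤ rect k l) : BoxSeq k l :=
  ⟨lam.rowLen, fun i => by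
    have := le_iff_rowLen_le.1 h i
    rw [rowLen_rect] at this
    split_ifs at this <;> omega, fun i hi => by
    have := le_iff_rowLen_le.1 h i
    rw [rowLen_rect, if_neg (by omega)] at this
    omega⟩

theorem rowLen_rotCompl {nu : YoungDiagram} (h : nu ≤ rect k l) (i : ℕ) :
    (rotCompl k l nu).rowLen i = (boxRows h).compl i := by
  rw [BoxSeq.compl_apply]
  change _ = if i < l then k - nu.rowLen (l - 1 - i) else 0
  refine eq_of_forall_lt_iff fun c => ?_
  rw [← YoungDiagram.mem_iff_lt_rowLen, ← YoungDiagram.mem_cells]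
  simp only [rotCompl, Finset.mem_image, Prod.exists, mem_skewCells, rowLen_rect, rotBox,
    Prod.mk.injEq]
  constructor
  · rintro ⟨r, d, ⟨h1, h2⟩, rfl, rfl⟩
    split_ifs at h2 with h3
    · rw [if_pos (by omega), show l - 1 - (l - 1 - r) = r by omega]
      omega
    · omega
  · intro hc
    split_ifs at hc with h3
    · exact ⟨l - 1 - i, k - 1 - c, ⟨by omega, by rw [if_pos (by omega)]; omega⟩, by omega, by omega⟩
    · omega

theorem rotCompl_le_rect {nu : YoungDiagram} (h : nu ≤ rect k l) : rotCompl k l nu ≤ rect k l := by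
  refine le_iff_rowLen_le.2 fun i => ?_
  rw [rowLen_rotCompl h, rowLen_rect, BoxSeq.compl_apply]
  split_ifs <;> omega

theorem lrCoeff_symm {lam mu nu : YoungDiagram} (hlam : lam ≤ rect k l) (hmu : mu ≤ rect k l)
    (hnu : nu ≤ rect k l) (hl : 0 < l) : lrCoeff lam mu nu = lrCoeff lam nu mu := by
  obtain ⟨n, rfl⟩ : ∃ n, l = n + 1 := ⟨l - 1, by omega⟩
  rw [← Nat.cast_inj (R := ℤ),
    lrCoeff_eq_schurMatrix (L := boxRows hlam) (M := boxRows hmu) (n := n) (fun _ => rfl)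
      (fun _ => rfl) (fun i hi => (boxRows hnu).eq_zero (by omega)),
    lrCoeff_eq_schurMatrix (L := boxRows hlam) (M := boxRows hnu) (n := n) (fun _ => rfl)
      (fun _ => rfl) (fun i hi => (boxRows hmu).eq_zero (by omega))]
  exact schurMatrix_symm (μ := boxRows hmu) (ν := boxRows hnu)
    (fun i j h => mu.rowLen_anti i j h) (fun i j h => nu.rowLen_anti i j h) _

theorem lrCoeff_rotCompl {lam mu nu : YoungDiagram} (hlam : lam ≤ rect k l) (hmu : mu ≤ rect k l)
    (hnu : nu ≤ rect k l) (hl : 0 < l) :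
    lrCoeff (rotCompl k l nu) (rotCompl k l lam) mu = lrCoeff lam nu mu := by
  obtain ⟨n, rfl⟩ : ∃ n, l = n + 1 := ⟨l - 1, by omega⟩
  rw [← Nat.cast_inj (R := ℤ),
    lrCoeff_eq_schurMatrix (L := (boxRows hnu).compl) (M := (boxRows hlam).compl) (n := n)
      (fun _ => (rowLen_rotCompl hnu _).symm) (fun _ => (rowLen_rotCompl hlam _).symm)
      (fun i hi => (boxRows hmu).eq_zero (by omega)),
    lrCoeff_eq_schurMatrix (L := boxRows hlam) (M := boxRows hnu) (n := n) (fun _ => rfl)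
      (fun _ => rfl) (fun i hi => (boxRows hmu).eq_zero (by omega))]
  exact schurMatrix_compl _ _ _

theorem lrCoeff_eq_zero_of_not_le {lam mu nu : YoungDiagram} (h : ¬ mu ≤ lam) :
    lrCoeff lam mu nu = 0 := by
  rw [lrCoeff, Set.ncard_eq_zero (finite_lrTableaux lam mu nu), Set.eq_empty_iff_forall_notMem]
  exact fun T hT => h hT.1

end Complement

end LittlewoodRichardson

open LittlewoodRichardson

theorem lemma4p1 (k l : ℕ) (hk : 0 < k) (hl : 0 < l) (lam mu nu : YoungDiagram)
    (hnu : nu ≤ lam) (hlam : lam < LittlewoodRichardson.rect k l) :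
    LittlewoodRichardson.lrCoeff lam mu nu =
      LittlewoodRichardson.lrCoeff (LittlewoodRichardson.rotCompl k l nu) mu
        (LittlewoodRichardson.rotCompl k l lam) := by
  have hlam' := hlam.le
  have hnu' := hnu.trans hlam'
  by_cases hmu : mu ≤ rect k l
  · rw [lrCoeff_symm hlam' hmu hnu' hl, ← lrCoeff_rotCompl hlam' hmu hnu' hl]
    exact lrCoeff_symm (rotCompl_le_rect hnu') (rotCompl_le_rect hlam') hmu hl
  -- Both outer shapes lie in the rectangle, so neither contains `mu`.
  · rw [lrCoeff_eq_zero_of_not_le fun h => hmu (h.trans hlam'),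
      lrCoeff_eq_zero_of_not_le fun h => hmu (h.trans (rotCompl_le_rect hnu'))]
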